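/- Let $M\in\mathbb{R}^{n\times p}$ have rank $r$ and (thin) singular value decomposition $M=U\,\mathrm{Diag}(s)\,V^\top$, where $U\in\mathbb{R}^{n\times r}$ and $V\in\mathbb{R}^{p\times r}$ have orthonormal columns $u_1,\dots,u_r$ and $v_1,\dots,v_r$, and $s_1\ge\dots\ge s_r>0$. Let $U_0\in\mathbb{R}^{n\times(n-r)}$ and $V_0\in\mathbb{R}^{p\times(p-r)}$ be matrices whose columns $u_{01},\dots,u_{0,n-r}$ and $v_{01},\dots,v_{0,p-r}$ are orthonormal bases of the orthogonal complements of the column spaces of $U$ and of $V$. Write $\|\cdot\|_*$ for the trace norm (the sum of the singular values) and $\|\cdot\|$ for the Frobenius norm. Then, as $\Delta\to 0$ in $\mathbb{R}^{n\times p}$, $$\|M+\Delta\|_*=\|M\|_*+\|Q\|_*+\operatorname{tr}(VU^\top\Delta)+\sum_{j=1}^r\sum_{k=1}^r\frac{(u_j^\top\Delta v_k-u_k^\top\Delta v_j)^2}{4(s_j+s_k)}+\sum_{j=1}^{p-r}\sum_{k=1}^r\frac{(u_k^\top\Delta v_{0j})^2}{2s_k}+\sum_{j=1}^{n-r}\sum_{k=1}^r\frac{(u_{0j}^\top\Delta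 v_k)^2}{2s_k}+o(\|\Delta\|^2),$$ where, with $S=\mathrm{Diag}(s)$, $Q=Q(\Delta)$ is the $n\times p$ block matrix $$Q=\begin{pmatrix}0 & -S^{-1}V^\top\Delta^\top U_0U_0^\top\Delta V_0\\[2pt] -U_0^\top\Delta V_0V_0^\top\Delta^\top US^{-1} & U_0^\top\Delta V_0-U_0^\top\Delta VS^{-1}U^\top\Delta V_0\end{pmatrix},$$ whose rows are split as $r+(n-r)$ and whose columns are split as $r+(p-r)$. -/

import Mathlib

open Filter Topology Asymptotics Matrix

-- `‖Δ‖` denotes the Frobenius norm of a matrix.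
open scoped Matrix.Norms.Frobenius

namespace TraceNorm

/-- The trace norm (nuclear norm) of a real matrix: the sum of its singular values. A matrix with
columns indexed by `κ` has at most `|κ|` nonzero singular values, which come first in the
decreasing sequence `LinearMap.singularValues`. -/
noncomputable def traceNorm {ι κ : Type*} [Fintype ι] [Fintype κ] [DecidableEq ι] [DecidableEq κ]
    (A : Matrix ι κ ℝ) : ℝ :=
  ∑ i ∈ Finset.range (Fintype.card κ), (Matrix.toEuclideanLin A).singularValues i

/-- `M = U Diag(s) Vᵀ` is a (thin) singular value decomposition of the real `n × p` matrix `M`: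
the columns of `U` and those of `V` are orthonormal and `s 0 ≥ s 1 ≥ ⋯ ≥ s (r - 1) > 0`. -/
structure IsSVD {n p r : ℕ} (M : Matrix (Fin n) (Fin p) ℝ) (U : Matrix (Fin n) (Fin r) ℝ)
    (s : Fin r → ℝ) (V : Matrix (Fin p) (Fin r) ℝ) : Prop where
  orthonormal_left : Uᵀ * U = 1
  orthonormal_right : Vᵀ * V = 1
  antitone : Antitone s
  pos : ∀ k, 0 < s k
  eq_mul : M = U * Matrix.diagonal s * Vᵀ

/-- The columns of `U₀` form an orthonormal basis of the orthogonal complement of the span of the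
columns of `U` (where `U` has `r` orthonormal columns, so that this complement has dimension
`n - r`). -/
structure IsOrthonormalCompletion {n r : ℕ} (U : Matrix (Fin n) (Fin r) ℝ)
    (U₀ : Matrix (Fin n) (Fin (n - r)) ℝ) : Prop where
  orthonormal : U₀ᵀ * U₀ = 1
  orthogonal : Uᵀ * U₀ = 0

/-- The matrix
`Q = U₀ᵀ Δ V₀ - U₀ᵀ Δ V₀ V₀ᵀ Δᵀ U Diag(s)⁻¹ - Diag(s)⁻¹ Vᵀ Δᵀ U₀ U₀ᵀ Δ V₀`
`- U₀ᵀ Δ V Diag(s)⁻¹ Uᵀ Δ V₀`.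
The four terms are coordinate blocks with respect to the orthonormal bases `(U, U₀)` of `ℝⁿ` and
`(V, V₀)` of `ℝᵖ`: the first and the last one send the span of `V₀` to the span of `U₀`, the second
one sends the span of `V` to the span of `U₀`, and the third one sends the span of `V₀` to the span
of `U`. The sum is taken in these coordinates. -/
noncomputable def Q {n p r : ℕ} (U : Matrix (Fin n) (Fin r) ℝ) (s : Fin r → ℝ)
    (V : Matrix (Fin p) (Fin r) ℝ) (U₀ : Matrix (Fin n) (Fin (n - r)) ℝ)
    (V₀ : Matrix (Fin p) (Fin (p - r)) ℝ) (Δ : Matrix (Fin n) (Fin p) ℝ) :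
    Matrix (Fin r ⊕ Fin (n - r)) (Fin r ⊕ Fin (p - r)) ℝ :=
  Matrix.fromBlocks
    0
    (-(Matrix.diagonal s⁻¹ * Vᵀ * Δᵀ * U₀ * U₀ᵀ * Δ * V₀))
    (-(U₀ᵀ * Δ * V₀ * V₀ᵀ * Δᵀ * U * Matrix.diagonal s⁻¹))
    (U₀ᵀ * Δ * V₀ - U₀ᵀ * Δ * V * Matrix.diagonal s⁻¹ * Uᵀ * Δ * V₀)

end TraceNorm

set_option linter.unusedSectionVars false

/-! In the orthonormal bases `(U, U₀)` and `(V, V₀)`, `M` becomes `S = diag(s) ⊕ 0` and `Δ` becomes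
a block matrix `Y` with blocks `A`, `B`, `C`, `D`; the trace norm is unchanged. Skew matrices `K₁`,
`K₂`, linear in `Y`, are chosen so that `K₁ S + S K₂ + Y` is block diagonal with a symmetric upper
block (`rotation_add`). Multiplying `S + Y` by the second-order truncations of `exp K₁` and `exp
K₂`, which are orthogonal up to fourth order, leaves a quadratic term `N`. A second pair of
rotations, of size `‖Δ‖²`, brings `N` to the same form (`isBigO_traceNorm_normalForm`).

The trace norm then splits over the two blocks. The upper one is a small symmetric perturbation of
`diag(s)`, hence positive semidefinite, so its trace norm is its trace: this yields `‖M‖_*`, the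
linear term and the quadratic sums (`trace_rotationRemainder`). The lower one is `D - C S⁻¹ B` up to
third order (`isBigO_traceNorm_expansion`).

The off-diagonal blocks of `Q` can themselves be rotated away: `Q` has size `‖Δ‖`, so rotations
orthogonal up to second order cost only third order (`isBigO_traceNorm_corrected`). All estimates
rest on trace-norm/operator-norm duality, and the remainder obtained is `O(‖Δ‖³)`. -/

namespace TraceNorm

/-! ### Duality between the trace norm and the operator norm. -/

section Duality

variable {ι κ μ ν : Type*} [Fintype ι] [Fintype κ] [Fintype μ] [Fintype ν]
  [DecidableEq ι] [DecidableEq κ] [DecidableEq μ] [DecidableEq ν]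

/-- The operator norm of a real matrix with respect to the Euclidean norms. -/
noncomputable def opNorm (A : Matrix ι κ ℝ) : ℝ :=
  ‖LinearMap.toContinuousLinearMap (Matrix.toEuclideanLin A)‖

lemma opNorm_nonneg (A : Matrix ι κ ℝ) : 0 ≤ opNorm A := norm_nonneg _

/-- The ambient matrix norm is the Frobenius norm, so the Euclidean operator norm is a plain
function; the `l2_opNorm` lemmas apply to it by unfolding. -/
lemma opNorm_mul (A : Matrix ι κ ℝ) (B : Matrix κ μ ℝ) : opNorm (A * B) ≤ opNorm A * opNorm B :=
  Matrix.l2_opNorm_mul A B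

lemma opNorm_transpose (A : Matrix ι κ ℝ) : opNorm Aᵀ = opNorm A := by
  have := Matrix.l2_opNorm_conjTranspose A
  rwa [Matrix.conjTranspose_eq_transpose_of_trivial] at this

lemma opNorm_transpose_mul_self (A : Matrix ι κ ℝ) : opNorm (Aᵀ * A) = opNorm A ^ 2 := by
  have := Matrix.l2_opNorm_conjTranspose_mul_self A
  rw [Matrix.conjTranspose_eq_transpose_of_trivial] at this
  rw [sq]; exact this

lemma opNorm_add (A B : Matrix ι κ ℝ) : opNorm (A + B) ≤ opNorm A + opNorm B := by
  unfold opNorm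
  rw [map_add, map_add]
  exact norm_add_le _ _

lemma norm_mulVec_le (A : Matrix ι κ ℝ) (x : κ → ℝ) :
    ‖WithLp.toLp 2 (A *ᵥ x)‖ ≤ opNorm A * ‖WithLp.toLp 2 x‖ :=
  (LinearMap.toContinuousLinearMap (Matrix.toEuclideanLin A)).le_opNorm (WithLp.toLp 2 x)

lemma opNorm_le_of_forall {A : Matrix ι κ ℝ} {c : ℝ} (hc : 0 ≤ c)
    (h : ∀ x : κ → ℝ, ‖WithLp.toLp 2 (A *ᵥ x)‖ ≤ c * ‖WithLp.toLp 2 x‖) : opNorm A ≤ c :=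
  ContinuousLinearMap.opNorm_le_bound _ hc fun x => h x.ofLp

/-- A vector is a one-column matrix, so this is submultiplicativity of the Frobenius norm. -/
lemma opNorm_le_norm (A : Matrix ι κ ℝ) : opNorm A ≤ ‖A‖ := by
  refine opNorm_le_of_forall (norm_nonneg _) fun x => ?_
  rw [← Matrix.frobenius_norm_replicateCol (ι := Unit), ← Matrix.frobenius_norm_replicateCol
    (ι := Unit), Matrix.replicateCol_mulVec]
  exact Matrix.frobenius_norm_mul _ _

lemma opNorm_diagonal_le {d : κ → ℝ} {c : ℝ} (hc : 0 ≤ c) (h : ∀ k, |d k| ≤ c) :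
    opNorm (Matrix.diagonal d) ≤ c := by
  have := Matrix.l2_opNorm_diagonal (𝕜 := ℝ) d
  have h2 : ‖d‖ ≤ c := (pi_norm_le_iff_of_nonneg hc).2 h
  exact this.trans_le h2

lemma opNorm_one_le : opNorm (1 : Matrix κ κ ℝ) ≤ 1 := by
  rw [← Matrix.diagonal_one]
  exact opNorm_diagonal_le zero_le_one (by simp)

lemma opNorm_le_one_of_transpose_mul_self {A : Matrix ι κ ℝ} (h : Aᵀ * A = 1) :
    opNorm A ≤ 1 := by
  have h1 := opNorm_transpose_mul_self A
  rw [h] at h1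
  have := opNorm_one_le (κ := κ)
  nlinarith [opNorm_nonneg A]

/-- A right singular basis: after an orthogonal change of basis of the source, the columns of `X`
become orthogonal, and their lengths are the singular values. -/
lemma exists_orthogonal_columns (X : Matrix ι κ ℝ) :
    ∃ (R : Matrix κ κ ℝ) (σ : κ → ℝ), Rᵀ * R = 1 ∧ R * Rᵀ = 1 ∧ (∀ k, 0 ≤ σ k) ∧
      (X * R)ᵀ * (X * R) = Matrix.diagonal (fun k => σ k ^ 2) ∧ traceNorm X = ∑ k, σ k := by
  have hH : (Xᵀ * X).IsHermitian := by
    have := Matrix.isHermitian_conjTranspose_mul_self X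
    rwa [Matrix.conjTranspose_eq_transpose_of_trivial] at this
  have hpsd : (Xᵀ * X).PosSemidef := by
    have := Matrix.posSemidef_conjTranspose_mul_self X
    rwa [Matrix.conjTranspose_eq_transpose_of_trivial] at this
  have hR1 : (hH.eigenvectorUnitary : Matrix κ κ ℝ)ᵀ * (hH.eigenvectorUnitary : Matrix κ κ ℝ) = 1 := by
    have := Unitary.coe_star_mul_self hH.eigenvectorUnitary
    rwa [Matrix.star_eq_conjTranspose, Matrix.conjTranspose_eq_transpose_of_trivial] at this
  have hR2 := mul_eq_one_comm.1 hR1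
  refine ⟨hH.eigenvectorUnitary, fun k => √(hH.eigenvalues k), hR1, hR2,
    fun k => Real.sqrt_nonneg _, ?_, ?_⟩
  · have hs := hH.spectral_theorem
    simp only [Unitary.conjStarAlgAut_apply] at hs
    rw [Matrix.star_eq_conjTranspose, Matrix.conjTranspose_eq_transpose_of_trivial] at hs
    rw [Matrix.transpose_mul, Matrix.mul_assoc, ← Matrix.mul_assoc Xᵀ]
    generalize hR : (hH.eigenvectorUnitary : Matrix κ κ ℝ) = R at *
    have h1 : Rᵀ * (Xᵀ * X * R) = diagonal (RCLike.ofReal ∘ hH.eigenvalues) := by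
      refine (congrArg (fun Y => Rᵀ * (Y * R)) hs).trans ?_
      simp only [Matrix.mul_assoc, hR1, Matrix.mul_one]
      rw [← Matrix.mul_assoc, hR1, Matrix.one_mul]
    rw [h1]
    congr 1
    ext k
    simp [Real.sq_sqrt (hpsd.eigenvalues_nonneg k)]
  · unfold traceNorm
    rw [← Fin.sum_univ_eq_sum_range (fun i => (Matrix.toEuclideanLin X).singularValues i)]
    refine Fintype.sum_equiv (Fintype.equivOfCardEq (Fintype.card_fin _)) _ _ fun i => ?_
    refine ((Matrix.toEuclideanLin X).singularValues_fin (n := Fintype.card κ)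
      finrank_euclideanSpace i).trans ?_
    -- The eigenvalues depend on a proof of symmetry, so equality of operators has to be transported
    -- with that proof generalized.
    have e : ∀ (T : EuclideanSpace ℝ κ →ₗ[ℝ] EuclideanSpace ℝ κ) (hT : T.IsSymmetric)
        (T' : EuclideanSpace ℝ κ →ₗ[ℝ] EuclideanSpace ℝ κ) (hT' : T'.IsSymmetric), T = T' →
        hT.eigenvalues finrank_euclideanSpace i = hT'.eigenvalues finrank_euclideanSpace i := by
      rintro T hT T' hT' rfl; rfl
    congr 1
    rw [Matrix.IsHermitian.eigenvalues, Equiv.symm_apply_apply]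
    apply e
    rw [← Matrix.toEuclideanLin_conjTranspose_eq_adjoint,
      Matrix.conjTranspose_eq_transpose_of_trivial]
    ext x : 1
    simp [Matrix.toLpLin_apply, Matrix.mulVec_mulVec]

lemma traceNorm_nonneg (X : Matrix ι κ ℝ) : 0 ≤ traceNorm X :=
  Finset.sum_nonneg fun i _ => LinearMap.singularValues_nonneg _ i

lemma norm_col_eq_of_transpose_mul_self {Y : Matrix ι κ ℝ} {σ : κ → ℝ} (hσ : ∀ k, 0 ≤ σ k)
    (h : Yᵀ * Y = Matrix.diagonal (fun k => σ k ^ 2)) (k : κ) :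
    ‖WithLp.toLp 2 (Y.col k)‖ = σ k := by
  have := congrFun (congrFun h k) k
  rw [Matrix.diagonal_apply_eq, Matrix.mul_apply] at this
  rw [EuclideanSpace.norm_eq, ← Real.sqrt_sq (hσ k), ← this]
  simp [sq]

lemma col_mul_eq_mulVec (A : Matrix ι κ ℝ) (B : Matrix κ μ ℝ) (k : μ) :
    (A * B).col k = A *ᵥ B.col k := by
  ext i; simp [Matrix.mul_apply, Matrix.mulVec, dotProduct]

lemma trace_transpose_mul_le_sum (W X : Matrix ι κ ℝ) :
    trace (Wᵀ * X) ≤ ∑ k, ‖WithLp.toLp 2 (W.col k)‖ * ‖WithLp.toLp 2 (X.col k)‖ := by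
  unfold trace
  refine Finset.sum_le_sum fun k _ => ?_
  have := real_inner_le_norm (WithLp.toLp 2 (W.col k)) (WithLp.toLp 2 (X.col k))
  refine le_trans (le_of_eq ?_) this
  simp [Matrix.mul_apply, PiLp.inner_apply, mul_comm]

/-- The trace norm is dual to the operator norm. -/
lemma trace_transpose_mul_le (W X : Matrix ι κ ℝ) :
    trace (Wᵀ * X) ≤ opNorm W * traceNorm X := by
  obtain ⟨R, σ, hR, hR', hσ, hY, hX⟩ := exists_orthogonal_columns X
  -- The pairing is invariant under `R`, and after rotation the columns of `X * R` have lengths `σ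
  -- k`.
  have h1 : trace (Wᵀ * X) = trace ((W * R)ᵀ * (X * R)) := by
    rw [Matrix.transpose_mul, Matrix.mul_assoc, Matrix.trace_mul_comm Rᵀ, ← Matrix.mul_assoc,
      Matrix.mul_assoc, hR', Matrix.mul_one]
  rw [h1, hX, Finset.mul_sum]
  refine (trace_transpose_mul_le_sum _ _).trans (Finset.sum_le_sum fun k _ => ?_)
  rw [norm_col_eq_of_transpose_mul_self hσ hY]
  refine mul_le_mul_of_nonneg_right ?_ (hσ k)
  rw [col_mul_eq_mulVec]
  refine (norm_mulVec_le _ _).trans (le_of_eq ?_)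
  rw [norm_col_eq_of_transpose_mul_self (σ := fun _ => 1) (fun _ => zero_le_one) (by simpa using hR),
    mul_one]

/-- The trace norm is attained by the polar factor. -/
lemma exists_trace_transpose_mul_eq (X : Matrix ι κ ℝ) :
    ∃ W : Matrix ι κ ℝ, opNorm W ≤ 1 ∧ trace (Wᵀ * X) = traceNorm X := by
  obtain ⟨R, σ, hR, hR', hσ, hY, hX⟩ := exists_orthogonal_columns X
  -- With `0⁻¹ = 0`, normalizing the columns of `X * R` leaves the null ones zero, so the Gram
  -- matrix has entries `0` or `1` on its diagonal.
  refine ⟨X * R * diagonal (fun k => (σ k)⁻¹) * Rᵀ, ?_, ?_⟩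
  · have hRn := opNorm_le_one_of_transpose_mul_self hR
    have hRn' := opNorm_transpose R
    have h1 : opNorm (X * R * diagonal (fun k => (σ k)⁻¹)) ≤ 1 := by
      have := opNorm_transpose_mul_self (X * R * diagonal (fun k => (σ k)⁻¹))
      rw [Matrix.transpose_mul, Matrix.mul_assoc, ← Matrix.mul_assoc (X * R)ᵀ, hY,
        diagonal_transpose, diagonal_mul_diagonal, diagonal_mul_diagonal] at this
      have h2 := opNorm_diagonal_le (d := fun k => (σ k)⁻¹ * (σ k ^ 2 * (σ k)⁻¹)) zero_le_one
        (fun k => by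
          by_cases h : σ k = 0
          · simp [h]
          · field_simp; simp)
      rw [this] at h2
      nlinarith [opNorm_nonneg (X * R * diagonal (fun k => (σ k)⁻¹))]
    refine (opNorm_mul _ _).trans ?_
    rw [hRn']
    nlinarith [opNorm_nonneg R, opNorm_nonneg (X * R * diagonal (fun k => (σ k)⁻¹))]
  · rw [hX, Matrix.transpose_mul, Matrix.transpose_mul, Matrix.mul_assoc, Matrix.trace_mul_comm,
      Matrix.transpose_transpose, Matrix.mul_assoc, Matrix.mul_assoc, hY, diagonal_transpose,
      diagonal_mul_diagonal, trace_diagonal]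
    refine Finset.sum_congr rfl fun k _ => ?_
    by_cases h : σ k = 0
    · simp [h]
    · field_simp

/-- Since the supremum over the unit ball is attained, upper bounds on trace norms reduce to bounds
on a linear pairing; the triangle inequality and the ideal property follow from this. -/
lemma traceNorm_le_of_forall {X : Matrix ι κ ℝ} {c : ℝ}
    (h : ∀ W : Matrix ι κ ℝ, opNorm W ≤ 1 → trace (Wᵀ * X) ≤ c) : traceNorm X ≤ c := by
  obtain ⟨W, hW, hX⟩ := exists_trace_transpose_mul_eq X
  exact hX ▸ h W hW

lemma trace_transpose_mul_le_traceNorm {W X : Matrix ι κ ℝ} (hW : opNorm W ≤ 1) :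
    trace (Wᵀ * X) ≤ traceNorm X :=
  (trace_transpose_mul_le W X).trans
    (mul_le_of_le_one_left (traceNorm_nonneg X) hW)

lemma traceNorm_add_le (X Y : Matrix ι κ ℝ) : traceNorm (X + Y) ≤ traceNorm X + traceNorm Y := by
  refine traceNorm_le_of_forall fun W hW => ?_
  rw [Matrix.mul_add, Matrix.trace_add]
  exact add_le_add (trace_transpose_mul_le_traceNorm hW) (trace_transpose_mul_le_traceNorm hW)

lemma traceNorm_mul_le_left (A : Matrix ι κ ℝ) (X : Matrix κ μ ℝ) :
    traceNorm (A * X) ≤ opNorm A * traceNorm X := by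
  refine traceNorm_le_of_forall fun W hW => ?_
  have := trace_transpose_mul_le (Aᵀ * W) X
  rw [Matrix.transpose_mul, Matrix.transpose_transpose, Matrix.mul_assoc] at this
  refine this.trans (mul_le_mul_of_nonneg_right ?_ (traceNorm_nonneg X))
  refine (opNorm_mul _ _).trans ?_
  rw [opNorm_transpose]
  exact mul_le_of_le_one_right (opNorm_nonneg A) hW

lemma traceNorm_transpose_le (X : Matrix ι κ ℝ) : traceNorm Xᵀ ≤ traceNorm X := by
  refine traceNorm_le_of_forall fun W hW => ?_
  have := trace_transpose_mul_le_traceNorm (W := Wᵀ) (X := X) (by rwa [opNorm_transpose])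
  rwa [← Matrix.trace_transpose, Matrix.transpose_mul, Matrix.transpose_transpose,
    Matrix.trace_mul_comm] at this

lemma traceNorm_transpose (X : Matrix ι κ ℝ) : traceNorm Xᵀ = traceNorm X :=
  le_antisymm (traceNorm_transpose_le X) (by simpa using traceNorm_transpose_le Xᵀ)

lemma traceNorm_le_card_mul_norm (X : Matrix ι κ ℝ) :
    traceNorm X ≤ Fintype.card κ * ‖X‖ := by
  obtain ⟨R, σ, hR, hR', hσ, hY, hX⟩ := exists_orthogonal_columns X
  rw [hX, ← nsmul_eq_mul]
  refine Finset.sum_le_card_nsmul _ _ _ fun k _ => ?_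
  rw [← norm_col_eq_of_transpose_mul_self hσ hY, col_mul_eq_mulVec]
  refine (norm_mulVec_le _ _).trans ?_
  rw [norm_col_eq_of_transpose_mul_self (σ := fun _ => 1) (fun _ => zero_le_one) (by simpa using hR),
    mul_one]
  exact opNorm_le_norm X

lemma traceNorm_neg (X : Matrix ι κ ℝ) : traceNorm (-X) = traceNorm X := by
  have h : ∀ X : Matrix ι κ ℝ, traceNorm (-X) ≤ traceNorm X := fun X => by
    refine traceNorm_le_of_forall fun W hW => ?_
    have := trace_transpose_mul_le_traceNorm (W := -W) (X := X) (by
      unfold opNorm at *; rwa [map_neg, map_neg, norm_neg])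
    simpa using this
  exact le_antisymm (h X) (by simpa using h (-X))

lemma abs_traceNorm_sub_le (X Y : Matrix ι κ ℝ) :
    |traceNorm X - traceNorm Y| ≤ Fintype.card κ * ‖X - Y‖ := by
  have h1 := traceNorm_add_le (X - Y) Y
  have h2 := traceNorm_add_le (-(X - Y)) X
  rw [traceNorm_neg] at h2
  rw [sub_add_cancel] at h1
  rw [neg_sub, sub_add_cancel] at h2
  have h3 := traceNorm_le_card_mul_norm (X - Y)
  exact abs_le.2 ⟨by linarith, by linarith⟩

lemma traceNorm_zero : traceNorm (0 : Matrix ι κ ℝ) = 0 :=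
  le_antisymm (by simpa using traceNorm_le_card_mul_norm (0 : Matrix ι κ ℝ)) (traceNorm_nonneg _)

lemma traceNorm_mul_left_of_orthogonal {A : Matrix ι κ ℝ} (h : Aᵀ * A = 1) (X : Matrix κ μ ℝ) :
    traceNorm (A * X) = traceNorm X := by
  have hA := opNorm_le_one_of_transpose_mul_self h
  refine le_antisymm ?_ ?_
  · exact (traceNorm_mul_le_left A X).trans (mul_le_of_le_one_left (traceNorm_nonneg _) hA)
  · have := traceNorm_mul_le_left Aᵀ (A * X)
    rw [← Matrix.mul_assoc, h, Matrix.one_mul, opNorm_transpose] at this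
    exact this.trans (mul_le_of_le_one_left (traceNorm_nonneg _) hA)

lemma traceNorm_mul_right_of_orthogonal {A : Matrix κ μ ℝ} (h : A * Aᵀ = 1) (X : Matrix ι κ ℝ) :
    traceNorm (X * A) = traceNorm X := by
  rw [← traceNorm_transpose, Matrix.transpose_mul,
    traceNorm_mul_left_of_orthogonal (by rwa [Matrix.transpose_transpose]), traceNorm_transpose]

/-- Multiplication by an almost orthogonal matrix almost preserves the trace norm. -/
lemma abs_traceNorm_mul_left_sub_le (W : Matrix κ κ ℝ) (X : Matrix κ μ ℝ) :
    |traceNorm (W * X) - traceNorm X|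
      ≤ ‖Wᵀ * W - 1‖ * (2 + ‖Wᵀ * W - 1‖) * traceNorm X := by
  set e := ‖Wᵀ * W - 1‖ with he
  have he0 : 0 ≤ e := norm_nonneg _
  have hX := traceNorm_nonneg X
  have hE : opNorm (Wᵀ * W - 1) ≤ e := opNorm_le_norm _
  have hW : opNorm W ≤ 1 + e := by
    have h1 := opNorm_transpose_mul_self W
    have h2 := opNorm_add (Wᵀ * W - 1) 1
    rw [sub_add_cancel, h1] at h2
    have h3 := opNorm_one_le (κ := κ)
    nlinarith [opNorm_nonneg W]
  have h1 : traceNorm (W * X) ≤ (1 + e) * traceNorm X :=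
    (traceNorm_mul_le_left W X).trans (mul_le_mul_of_nonneg_right hW hX)
  -- `X = Wᵀ (W X) - (Wᵀ W - 1) X`, so `Wᵀ` serves as an approximate inverse.
  have h2 : traceNorm X ≤ (1 + e) * traceNorm (W * X) + e * traceNorm X := by
    have h3 := traceNorm_add_le (Wᵀ * (W * X)) (-((Wᵀ * W - 1) * X))
    rw [traceNorm_neg, ← sub_eq_add_neg, Matrix.sub_mul, Matrix.one_mul, Matrix.mul_assoc,
      sub_sub_cancel] at h3
    have h4 := (traceNorm_mul_le_left Wᵀ (W * X)).trans
      (mul_le_mul_of_nonneg_right ((opNorm_transpose W).trans_le hW) (traceNorm_nonneg _))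
    have h5 := (traceNorm_mul_le_left (Wᵀ * W - 1) X).trans (mul_le_mul_of_nonneg_right hE hX)
    rw [Matrix.sub_mul, Matrix.one_mul, Matrix.mul_assoc] at h5
    linarith
  have h6 := mul_le_mul_of_nonneg_left h1 he0
  refine abs_le.2 ⟨?_, ?_⟩
  · nlinarith
  · nlinarith [mul_nonneg he0 hX, mul_nonneg (mul_nonneg he0 he0) hX]

/-- For `P = Bᵀ B`, the pairing with a contraction `W` is that of `W Bᵀ` with `Bᵀ`; Cauchy–Schwarz
on columns bounds it by the squared Frobenius norm of `B`, which is the trace. The choice `W = 1`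
attains it. -/
lemma traceNorm_of_posSemidef {P : Matrix κ κ ℝ} (hP : P.PosSemidef) :
    traceNorm P = trace P := by
  refine le_antisymm ?_ ?_
  · refine traceNorm_le_of_forall fun W hW => ?_
    obtain ⟨B, rfl⟩ : ∃ B : Matrix κ κ ℝ, P = Bᵀ * B := by
      open scoped MatrixOrder in
      obtain ⟨B, hB⟩ := CStarAlgebra.nonneg_iff_eq_star_mul_self.1 hP.nonneg
      exact ⟨B, by rwa [Matrix.star_eq_conjTranspose,
        Matrix.conjTranspose_eq_transpose_of_trivial] at hB⟩
    have h1 : trace (Wᵀ * (Bᵀ * B)) = trace ((W * Bᵀ)ᵀ * Bᵀ) := by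
      rw [Matrix.transpose_mul, Matrix.transpose_transpose, Matrix.mul_assoc,
        ← Matrix.mul_assoc Wᵀ, Matrix.trace_mul_comm]
    rw [h1, Matrix.trace_mul_comm Bᵀ B]
    refine (trace_transpose_mul_le_sum _ _).trans ?_
    unfold trace
    refine Finset.sum_le_sum fun k _ => ?_
    rw [col_mul_eq_mulVec]
    have h2 := norm_mulVec_le W (Bᵀ.col k)
    have h3 : (B * Bᵀ).diag k = ‖WithLp.toLp 2 (Bᵀ.col k)‖ ^ 2 := by
      rw [EuclideanSpace.norm_sq_eq]
      simp [Matrix.mul_apply, sq]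
    rw [h3, sq]
    refine mul_le_mul_of_nonneg_right ?_ (norm_nonneg _)
    exact h2.trans (mul_le_of_le_one_left (norm_nonneg _) hW)
  · simpa using trace_transpose_mul_le_traceNorm (W := (1 : Matrix κ κ ℝ)) (X := P) opNorm_one_le

lemma norm_sq_toLp_sum (x : ι ⊕ κ → ℝ) :
    ‖WithLp.toLp 2 x‖ ^ 2 = ‖WithLp.toLp 2 (x ∘ Sum.inl)‖ ^ 2 + ‖WithLp.toLp 2 (x ∘ Sum.inr)‖ ^ 2 := by
  simp [EuclideanSpace.norm_sq_eq]

lemma opNorm_fromBlocks_diag_le {P : Matrix ι κ ℝ} {D : Matrix μ ν ℝ} (hP : opNorm P ≤ 1)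
    (hD : opNorm D ≤ 1) : opNorm (fromBlocks P 0 0 D) ≤ 1 := by
  refine opNorm_le_of_forall zero_le_one fun x => ?_
  rw [one_mul]
  refine (sq_le_sq₀ (norm_nonneg _) (norm_nonneg _)).1 ?_
  rw [norm_sq_toLp_sum, norm_sq_toLp_sum x, fromBlocks_mulVec]
  simp only [Sum.elim_comp_inl, Sum.elim_comp_inr, zero_mulVec, add_zero, zero_add]
  have h1 := (norm_mulVec_le P (x ∘ Sum.inl)).trans (mul_le_of_le_one_left (norm_nonneg _) hP)
  have h2 := (norm_mulVec_le D (x ∘ Sum.inr)).trans (mul_le_of_le_one_left (norm_nonneg _) hD)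
  gcongr

/-- Extending a vector by zero is an isometry, and dropping coordinates of the image does not
increase the norm. -/
lemma opNorm_toBlocks₁₁_le (W : Matrix (ι ⊕ μ) (κ ⊕ ν) ℝ) : opNorm W.toBlocks₁₁ ≤ opNorm W := by
  refine opNorm_le_of_forall (opNorm_nonneg _) fun x => ?_
  have h := norm_mulVec_le W (Sum.elim x 0)
  have h1 : ‖WithLp.toLp 2 (Sum.elim x (0 : ν → ℝ))‖ = ‖WithLp.toLp 2 x‖ := by
    refine (sq_eq_sq₀ (norm_nonneg _) (norm_nonneg _)).1 ?_
    rw [norm_sq_toLp_sum]; simp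
  rw [h1] at h
  refine le_trans ((sq_le_sq₀ (norm_nonneg _) (norm_nonneg _)).1 ?_) h
  rw [norm_sq_toLp_sum (W *ᵥ _)]
  have h2 : (W *ᵥ (Sum.elim x 0)) ∘ Sum.inl = W.toBlocks₁₁ *ᵥ x := by
    conv_lhs => rw [← fromBlocks_toBlocks W, fromBlocks_mulVec]
    simp
  rw [h2]
  exact le_add_of_nonneg_right (sq_nonneg _)

lemma opNorm_toBlocks₂₂_le (W : Matrix (ι ⊕ μ) (κ ⊕ ν) ℝ) : opNorm W.toBlocks₂₂ ≤ opNorm W := by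
  refine opNorm_le_of_forall (opNorm_nonneg _) fun x => ?_
  have h := norm_mulVec_le W (Sum.elim 0 x)
  have h1 : ‖WithLp.toLp 2 (Sum.elim (0 : κ → ℝ) x)‖ = ‖WithLp.toLp 2 x‖ := by
    refine (sq_eq_sq₀ (norm_nonneg _) (norm_nonneg _)).1 ?_
    rw [norm_sq_toLp_sum]; simp
  rw [h1] at h
  refine le_trans ((sq_le_sq₀ (norm_nonneg _) (norm_nonneg _)).1 ?_) h
  rw [norm_sq_toLp_sum (W *ᵥ _)]
  have h2 : (W *ᵥ (Sum.elim 0 x)) ∘ Sum.inr = W.toBlocks₂₂ *ᵥ x := by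
    conv_lhs => rw [← fromBlocks_toBlocks W, fromBlocks_mulVec]
    simp
  rw [h2]
  exact le_add_of_nonneg_left (sq_nonneg _)

lemma trace_fromBlocks_eq (A : Matrix ι ι ℝ) (B : Matrix ι κ ℝ) (C : Matrix κ ι ℝ)
    (D : Matrix κ κ ℝ) : trace (fromBlocks A B C D) = trace A + trace D := by
  simp [trace]

/-- The trace norm is additive over block-diagonal matrices. -/
lemma traceNorm_fromBlocks_diag (P : Matrix ι κ ℝ) (D : Matrix μ ν ℝ) :
    traceNorm (fromBlocks P 0 0 D) = traceNorm P + traceNorm D := by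
  refine le_antisymm ?_ ?_
  · refine traceNorm_le_of_forall fun W hW => ?_
    have h1 : trace (Wᵀ * fromBlocks P 0 0 D)
        = trace (W.toBlocks₁₁ᵀ * P) + trace (W.toBlocks₂₂ᵀ * D) := by
      conv_lhs => rw [← fromBlocks_toBlocks W, fromBlocks_transpose, fromBlocks_multiply,
        trace_fromBlocks_eq]
      simp
    rw [h1]
    exact add_le_add (trace_transpose_mul_le_traceNorm ((opNorm_toBlocks₁₁_le W).trans hW))
      (trace_transpose_mul_le_traceNorm ((opNorm_toBlocks₂₂_le W).trans hW))
  · obtain ⟨W₁, hW₁, h₁⟩ := exists_trace_transpose_mul_eq P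
    obtain ⟨W₂, hW₂, h₂⟩ := exists_trace_transpose_mul_eq D
    have := trace_transpose_mul_le_traceNorm (X := fromBlocks P 0 0 D)
      (opNorm_fromBlocks_diag_le hW₁ hW₂)
    rw [fromBlocks_transpose, fromBlocks_multiply, trace_fromBlocks_eq] at this
    simpa [h₁, h₂] using this

end Duality

/-! ### Calculus of orders of magnitude for matrix families. -/

section BigO

variable {α ι κ μ ν : Type*} [Fintype ι] [Fintype κ] [Fintype μ] [Fintype ν]
  [DecidableEq ι] [DecidableEq κ] [DecidableEq μ] [DecidableEq ν] {l : Filter α} {ε : α → ℝ}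

lemma isBigO_mul_pow {A : α → Matrix ι κ ℝ} {B : α → Matrix κ μ ℝ} {a b : ℕ}
    (hA : A =O[l] fun t => ε t ^ a) (hB : B =O[l] fun t => ε t ^ b) :
    (fun t => A t * B t) =O[l] fun t => ε t ^ (a + b) := by
  have h := hA.norm_left.mul hB.norm_left
  simp only [← pow_add] at h
  refine IsBigO.trans (IsBigO.of_bound 1 (Eventually.of_forall fun t => ?_)) h
  rw [one_mul, norm_mul, norm_norm, norm_norm]
  exact Matrix.frobenius_norm_mul _ _

lemma isBigO_const_pow_zero (A : Matrix ι κ ℝ) : (fun _ : α => A) =O[l] fun t => ε t ^ 0 := by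
  simpa using isBigO_const_const A (one_ne_zero (α := ℝ)) l

lemma isBigO_pow_of_le (hε : Tendsto ε l (𝓝 0)) {E : Type*} [NormedAddCommGroup E] {A : α → E}
    {a b : ℕ} (hab : a ≤ b) (hA : A =O[l] fun t => ε t ^ b) : A =O[l] fun t => ε t ^ a := by
  refine hA.trans (IsBigO.of_bound 1 ?_)
  filter_upwards [hε.eventually (Metric.ball_mem_nhds (0 : ℝ) one_pos)] with t ht
  rw [one_mul, norm_pow, norm_pow]
  exact pow_le_pow_of_le_one (norm_nonneg _) (by simpa using ht.le) hab

lemma isBigO_mul_pow_le (hε : Tendsto ε l (𝓝 0)) {A : α → Matrix ι κ ℝ} {B : α → Matrix κ μ ℝ}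
    {a b c : ℕ} (hc : c ≤ a + b) (hA : A =O[l] fun t => ε t ^ a) (hB : B =O[l] fun t => ε t ^ b) :
    (fun t => A t * B t) =O[l] fun t => ε t ^ c :=
  isBigO_pow_of_le hε hc (isBigO_mul_pow hA hB)

lemma isBigO_smul {A : α → Matrix ι κ ℝ} {g : α → ℝ} (c : ℝ) (hA : A =O[l] g) :
    (fun t => c • A t) =O[l] g :=
  hA.const_smul_left c

lemma isBigO_linear {f : Matrix ι κ ℝ → Matrix μ ν ℝ} (hf : IsLinearMap ℝ f)
    {A : α → Matrix ι κ ℝ} {g : α → ℝ} (hA : A =O[l] g) : (fun t => f (A t)) =O[l] g := by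
  refine IsBigO.trans ?_ hA
  exact (LinearMap.toContinuousLinearMap (IsLinearMap.mk' f hf)).isBigO_comp A l

lemma isBigO_traceNorm_sub {A B : α → Matrix ι κ ℝ} {g : α → ℝ}
    (h : (fun t => A t - B t) =O[l] g) :
    (fun t => traceNorm (A t) - traceNorm (B t)) =O[l] g := by
  refine IsBigO.trans (IsBigO.of_bound (Fintype.card κ) (Eventually.of_forall fun t => ?_)) h
  exact abs_traceNorm_sub_le _ _

lemma isBigO_traceNorm {A : α → Matrix ι κ ℝ} {g : α → ℝ} (h : A =O[l] g) :
    (fun t => traceNorm (A t)) =O[l] g := by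
  simpa [traceNorm_zero] using isBigO_traceNorm_sub (B := fun _ => 0) (by simpa using h)

lemma isBigO_traceNorm_mul_left_sub (hε : Tendsto ε l (𝓝 0)) {W : α → Matrix κ κ ℝ}
    {X : α → Matrix κ μ ℝ} {a b : ℕ}
    (hW : (fun t => (W t)ᵀ * W t - 1) =O[l] fun t => ε t ^ a) (hX : X =O[l] fun t => ε t ^ b) :
    (fun t => traceNorm (W t * X t) - traceNorm (X t)) =O[l] fun t => ε t ^ (a + b) := by
  have h0 : (fun t => 2 + ‖(W t)ᵀ * W t - 1‖) =O[l] fun t => ε t ^ 0 := by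
    have h1 := isBigO_pow_of_le hε (Nat.zero_le a) hW.norm_left
    refine IsBigO.add ?_ h1
    simpa using isBigO_const_const (2 : ℝ) (one_ne_zero (α := ℝ)) l
  have h := (hW.norm_left.mul h0).mul (isBigO_traceNorm hX)
  simp only [← pow_add, add_zero] at h
  refine IsBigO.trans (IsBigO.of_bound 1 (Eventually.of_forall fun t => ?_)) h
  rw [one_mul]
  exact (abs_traceNorm_mul_left_sub_le _ _).trans (Real.le_norm_self _)

lemma isBigO_transpose {A : α → Matrix ι κ ℝ} {g : α → ℝ} (hA : A =O[l] g) :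
    (fun t => (A t)ᵀ) =O[l] g := by
  refine IsBigO.trans (IsBigO.of_bound 1 (Eventually.of_forall fun t => ?_)) hA
  rw [one_mul, Matrix.frobenius_norm_transpose]

lemma isBigO_traceNorm_mul_right_sub (hε : Tendsto ε l (𝓝 0)) {W : α → Matrix κ κ ℝ}
    {X : α → Matrix ι κ ℝ} {a b : ℕ}
    (hW : (fun t => W t * (W t)ᵀ - 1) =O[l] fun t => ε t ^ a) (hX : X =O[l] fun t => ε t ^ b) :
    (fun t => traceNorm (X t * W t) - traceNorm (X t)) =O[l] fun t => ε t ^ (a + b) := by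
  have := isBigO_traceNorm_mul_left_sub hε (W := fun t => (W t)ᵀ) (X := fun t => (X t)ᵀ)
    (by simpa using hW) (isBigO_transpose hX)
  simpa only [← Matrix.transpose_mul, traceNorm_transpose] using this

/-- The error is the orthogonality defect times the size of `X`. It is used twice: defect `ε³` with
bounded `X`, and defect `ε²` with `X` of order `ε`. -/
lemma isBigO_traceNorm_conj_sub (hε : Tendsto ε l (𝓝 0)) {W₁ : α → Matrix ι ι ℝ}
    {W₂ : α → Matrix κ κ ℝ} {X : α → Matrix ι κ ℝ} {a b : ℕ}
    (h₁ : (fun t => (W₁ t)ᵀ * W₁ t - 1) =O[l] fun t => ε t ^ a)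
    (h₂ : (fun t => W₂ t * (W₂ t)ᵀ - 1) =O[l] fun t => ε t ^ a)
    (hW₁ : W₁ =O[l] fun t => ε t ^ 0) (hX : X =O[l] fun t => ε t ^ b) :
    (fun t => traceNorm (W₁ t * X t * W₂ t) - traceNorm (X t)) =O[l] fun t => ε t ^ (a + b) := by
  have e₁ := isBigO_traceNorm_mul_left_sub hε h₁ hX
  have e₂ := isBigO_traceNorm_mul_right_sub hε h₂
    ((isBigO_mul_pow hW₁ hX).congr_right fun t => by rw [zero_add])
  simpa using e₂.add e₁

lemma isBigO_fromBlocks {A : α → Matrix ι κ ℝ} {B : α → Matrix ι ν ℝ} {C : α → Matrix μ κ ℝ}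
    {D : α → Matrix μ ν ℝ} {g : α → ℝ} (hA : A =O[l] g) (hB : B =O[l] g) (hC : C =O[l] g)
    (hD : D =O[l] g) : (fun t => fromBlocks (A t) (B t) (C t) (D t)) =O[l] g := by
  have h₁ := isBigO_linear (f := fun A : Matrix ι κ ℝ =>
    fromBlocks A (0 : Matrix ι ν ℝ) (0 : Matrix μ κ ℝ) 0)
    ⟨fun _ _ => by simp [fromBlocks_add], fun _ _ => by simp [fromBlocks_smul]⟩ hA
  have h₂ := isBigO_linear (f := fun B : Matrix ι ν ℝ =>
    fromBlocks (0 : Matrix ι κ ℝ) B (0 : Matrix μ κ ℝ) 0)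
    ⟨fun _ _ => by simp [fromBlocks_add], fun _ _ => by simp [fromBlocks_smul]⟩ hB
  have h₃ := isBigO_linear (f := fun C : Matrix μ κ ℝ =>
    fromBlocks (0 : Matrix ι κ ℝ) (0 : Matrix ι ν ℝ) C 0)
    ⟨fun _ _ => by simp [fromBlocks_add], fun _ _ => by simp [fromBlocks_smul]⟩ hC
  have h₄ := isBigO_linear (f := fun D : Matrix μ ν ℝ =>
    fromBlocks (0 : Matrix ι κ ℝ) (0 : Matrix ι ν ℝ) 0 D)
    ⟨fun _ _ => by simp [fromBlocks_add], fun _ _ => by simp [fromBlocks_smul]⟩ hD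
  simpa [fromBlocks_add] using ((h₁.add h₂).add h₃).add h₄

end BigO

/-! ### Approximately orthogonal matrices built from skew ones. -/

section Skew

variable {κ : Type*} [Fintype κ] [DecidableEq κ]

lemma one_add_transpose_mul_self_of_skew {K : Matrix κ κ ℝ} (hK : Kᵀ = -K) :
    (1 + K)ᵀ * (1 + K) - 1 = -(K * K) := by
  rw [transpose_add, hK, transpose_one]; noncomm_ring

lemma one_add_mul_transpose_of_skew {K : Matrix κ κ ℝ} (hK : Kᵀ = -K) :
    (1 + K) * (1 + K)ᵀ - 1 = -(K * K) := by
  rw [transpose_add, hK, transpose_one]; noncomm_ring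

/-- The second order Taylor polynomial of the matrix exponential. -/
noncomputable def expTwo (K : Matrix κ κ ℝ) : Matrix κ κ ℝ := 1 + K + (1 / 2 : ℝ) • (K * K)

/-- The product is `(1 + K²/2)² - K²`, in which the quadratic terms cancel. -/
lemma expTwo_transpose_mul_self_of_skew {K : Matrix κ κ ℝ} (hK : Kᵀ = -K) :
    (expTwo K)ᵀ * expTwo K - 1 = (1 / 4 : ℝ) • (K * K * (K * K)) := by
  simp only [expTwo, transpose_add, transpose_smul, transpose_mul, hK, transpose_one,
    Matrix.mul_add, Matrix.add_mul, Matrix.smul_mul, Matrix.mul_smul, Matrix.one_mul,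
    Matrix.mul_one, Matrix.neg_mul, Matrix.mul_neg, Matrix.mul_assoc]
  module

lemma expTwo_mul_transpose_of_skew {K : Matrix κ κ ℝ} (hK : Kᵀ = -K) :
    expTwo K * (expTwo K)ᵀ - 1 = (1 / 4 : ℝ) • (K * K * (K * K)) := by
  simp only [expTwo, transpose_add, transpose_smul, transpose_mul, hK, transpose_one,
    Matrix.mul_add, Matrix.add_mul, Matrix.smul_mul, Matrix.mul_smul, Matrix.one_mul,
    Matrix.mul_one, Matrix.neg_mul, Matrix.mul_neg, Matrix.mul_assoc]
  module

end Skew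

/-! ### Rotations that block-diagonalize the perturbation, and their second-order remainder. -/

section Rotation

variable {ρ μ ν : Type*} [Fintype ρ] [Fintype μ] [Fintype ν]
  [DecidableEq ρ] [DecidableEq μ] [DecidableEq ν] (s : ρ → ℝ)

/-- The skew-symmetric `K` for which `A + K * diagonal s` is symmetric. -/
noncomputable def symmetrizer (A : Matrix ρ ρ ℝ) : Matrix ρ ρ ℝ :=
  Matrix.of fun j k => (A k j - A j k) / (s j + s k)

lemma symmetrizer_apply (A : Matrix ρ ρ ℝ) (j k : ρ) :
    symmetrizer s A j k = (A k j - A j k) / (s j + s k) := rfl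

lemma symmetrizer_transpose (A : Matrix ρ ρ ℝ) : (symmetrizer s A)ᵀ = -symmetrizer s A := by
  ext j k
  rw [transpose_apply, Matrix.neg_apply, symmetrizer_apply, symmetrizer_apply, add_comm (s k)]
  ring

lemma isLinearMap_symmetrizer : IsLinearMap ℝ (symmetrizer s) := by
  constructor
  · intro A B; ext j k; simp [symmetrizer_apply]; ring
  · intro c A; ext j k; simp [symmetrizer_apply]; ring

/-- Symmetry of `A + K * diagonal s` with `K` skew reads `K j k * (s j + s k) = A k j - A j k`;
positivity of `s` makes this solvable. -/
lemma add_symmetrizer_isSymm {s : ρ → ℝ} (hs : ∀ k, 0 < s k) (A : Matrix ρ ρ ℝ) :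
    (A + symmetrizer s A * diagonal s).IsSymm := by
  ext j k
  have := (add_pos (hs j) (hs k)).ne'
  rw [transpose_apply, Matrix.add_apply, Matrix.add_apply, mul_diagonal, mul_diagonal,
    symmetrizer_apply, symmetrizer_apply, add_comm (s k)]
  field_simp
  ring

variable (μ ν) in
/-- The rectangular matrix with diagonal `s`, padded with zeros. -/
def singularBlock : Matrix (ρ ⊕ μ) (ρ ⊕ ν) ℝ := fromBlocks (diagonal s) 0 0 0

/-- The infinitesimal rotation of the target which, together with `rightRotation`, removes the
perturbation `Y` of `singularBlock` to first order, up to a block-diagonal term. -/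
noncomputable def leftRotation (Y : Matrix (ρ ⊕ μ) (ρ ⊕ ν) ℝ) : Matrix (ρ ⊕ μ) (ρ ⊕ μ) ℝ :=
  fromBlocks (symmetrizer s Y.toBlocks₁₁) (diagonal s⁻¹ * Y.toBlocks₂₁ᵀ)
    (-(Y.toBlocks₂₁ * diagonal s⁻¹)) 0

/-- The infinitesimal rotation of the source, see `leftRotation`. -/
noncomputable def rightRotation (Y : Matrix (ρ ⊕ μ) (ρ ⊕ ν) ℝ) : Matrix (ρ ⊕ ν) (ρ ⊕ ν) ℝ :=
  fromBlocks 0 (-(diagonal s⁻¹ * Y.toBlocks₁₂)) (Y.toBlocks₁₂ᵀ * diagonal s⁻¹) 0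

/-- What remains of the perturbation `Y` after the rotation. -/
noncomputable def normalForm (Y : Matrix (ρ ⊕ μ) (ρ ⊕ ν) ℝ) : Matrix (ρ ⊕ μ) (ρ ⊕ ν) ℝ :=
  fromBlocks (Y.toBlocks₁₁ + symmetrizer s Y.toBlocks₁₁ * diagonal s) 0 0 Y.toBlocks₂₂

/-- The second order terms left by the rotation of `singularBlock μ ν s + Y`. -/
noncomputable def rotationRemainder (Y : Matrix (ρ ⊕ μ) (ρ ⊕ ν) ℝ) :
    Matrix (ρ ⊕ μ) (ρ ⊕ ν) ℝ :=
  leftRotation s Y * Y + Y * rightRotation s Y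
    + leftRotation s Y * singularBlock μ ν s * rightRotation s Y
    + (1 / 2 : ℝ) • (leftRotation s Y * (leftRotation s Y * singularBlock μ ν s))
    + (1 / 2 : ℝ) • (singularBlock μ ν s * rightRotation s Y * rightRotation s Y)

lemma leftRotation_transpose (Y : Matrix (ρ ⊕ μ) (ρ ⊕ ν) ℝ) :
    (leftRotation s Y)ᵀ = -leftRotation s Y := by
  simp [leftRotation, fromBlocks_transpose, fromBlocks_neg, symmetrizer_transpose]

lemma rightRotation_transpose (Y : Matrix (ρ ⊕ μ) (ρ ⊕ ν) ℝ) :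
    (rightRotation s Y)ᵀ = -rightRotation s Y := by
  simp [rightRotation, fromBlocks_transpose, fromBlocks_neg]

lemma isLinearMap_leftRotation :
    IsLinearMap ℝ (leftRotation s : Matrix (ρ ⊕ μ) (ρ ⊕ ν) ℝ → _) := by
  constructor
  · intro A B
    have h₁ : (A + B).toBlocks₁₁ = A.toBlocks₁₁ + B.toBlocks₁₁ := rfl
    have h₂ : (A + B).toBlocks₂₁ = A.toBlocks₂₁ + B.toBlocks₂₁ := rfl
    simp only [leftRotation, fromBlocks_add, h₁, h₂, (isLinearMap_symmetrizer s).map_add,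
      transpose_add, Matrix.mul_add, Matrix.add_mul, neg_add, add_zero]
  · intro c A
    have h₁ : (c • A).toBlocks₁₁ = c • A.toBlocks₁₁ := rfl
    have h₂ : (c • A).toBlocks₂₁ = c • A.toBlocks₂₁ := rfl
    simp only [leftRotation, fromBlocks_smul, h₁, h₂, (isLinearMap_symmetrizer s).map_smul,
      transpose_smul, Matrix.mul_smul, Matrix.smul_mul, smul_neg, smul_zero]

lemma isLinearMap_rightRotation :
    IsLinearMap ℝ (rightRotation s : Matrix (ρ ⊕ μ) (ρ ⊕ ν) ℝ → _) := by
  constructor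
  · intro A B
    have h₂ : (A + B).toBlocks₁₂ = A.toBlocks₁₂ + B.toBlocks₁₂ := rfl
    simp only [rightRotation, fromBlocks_add, h₂,
      transpose_add, Matrix.mul_add, Matrix.add_mul, neg_add, add_zero]
  · intro c A
    have h₂ : (c • A).toBlocks₁₂ = c • A.toBlocks₁₂ := rfl
    simp only [rightRotation, fromBlocks_smul, h₂,
      transpose_smul, Matrix.mul_smul, Matrix.smul_mul, smul_neg, smul_zero]

lemma isLinearMap_normalForm :
    IsLinearMap ℝ (normalForm s : Matrix (ρ ⊕ μ) (ρ ⊕ ν) ℝ → _) := by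
  constructor
  · intro A B
    have h₁ : (A + B).toBlocks₁₁ = A.toBlocks₁₁ + B.toBlocks₁₁ := rfl
    have h₂ : (A + B).toBlocks₂₂ = A.toBlocks₂₂ + B.toBlocks₂₂ := rfl
    simp only [normalForm, fromBlocks_add, h₁, h₂, (isLinearMap_symmetrizer s).map_add,
      Matrix.add_mul, add_zero, add_add_add_comm]
  · intro c A
    have h₁ : (c • A).toBlocks₁₁ = c • A.toBlocks₁₁ := rfl
    have h₂ : (c • A).toBlocks₂₂ = c • A.toBlocks₂₂ := rfl
    simp only [normalForm, fromBlocks_smul, h₁, h₂, (isLinearMap_symmetrizer s).map_smul,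
      Matrix.smul_mul, smul_add, smul_zero]

variable {s}

lemma diagonal_inv_mul_diagonal (hs : ∀ k, 0 < s k) : diagonal s⁻¹ * diagonal s = 1 := by
  rw [diagonal_mul_diagonal, ← diagonal_one]
  congr 1; ext k; simp [(hs k).ne']

lemma diagonal_mul_diagonal_inv (hs : ∀ k, 0 < s k) : diagonal s * diagonal s⁻¹ = 1 := by
  rw [diagonal_mul_diagonal, ← diagonal_one]
  congr 1; ext k; simp [(hs k).ne']

lemma leftRotation_mul (hs : ∀ k, 0 < s k) (Y : Matrix (ρ ⊕ μ) (ρ ⊕ ν) ℝ) :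
    leftRotation s Y * singularBlock μ ν s
      = fromBlocks (symmetrizer s Y.toBlocks₁₁ * diagonal s) 0 (-Y.toBlocks₂₁) 0 := by
  rw [leftRotation, singularBlock, fromBlocks_multiply]
  simp [Matrix.mul_assoc, diagonal_inv_mul_diagonal hs]

lemma mul_rightRotation (hs : ∀ k, 0 < s k) (Y : Matrix (ρ ⊕ μ) (ρ ⊕ ν) ℝ) :
    singularBlock μ ν s * rightRotation s Y
      = fromBlocks 0 (-Y.toBlocks₁₂) 0 0 := by
  rw [rightRotation, singularBlock, fromBlocks_multiply]
  simp [← Matrix.mul_assoc, diagonal_mul_diagonal_inv hs]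

/-- The factors `S⁻¹` in the rotations undo `S`, so the left one cancels the lower-left block and
the right one the upper-right block. -/
lemma rotation_add (hs : ∀ k, 0 < s k) (Y : Matrix (ρ ⊕ μ) (ρ ⊕ ν) ℝ) :
    leftRotation s Y * singularBlock μ ν s
      + singularBlock μ ν s * rightRotation s Y + Y = normalForm s Y := by
  rw [leftRotation_mul hs, mul_rightRotation hs]
  conv_lhs => rw [← fromBlocks_toBlocks Y]
  simp [fromBlocks_add, normalForm, add_comm]

/-- Only the diagonal blocks are needed, since `normalForm` discards the others. -/
lemma rotationRemainder_eq (hs : ∀ k, 0 < s k) (Y : Matrix (ρ ⊕ μ) (ρ ⊕ ν) ℝ) :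
    (rotationRemainder s Y).toBlocks₁₁ = symmetrizer s Y.toBlocks₁₁ * Y.toBlocks₁₁
      + (1 / 2 : ℝ) • (symmetrizer s Y.toBlocks₁₁ * (symmetrizer s Y.toBlocks₁₁ * diagonal s))
      + (1 / 2 : ℝ) • (diagonal s⁻¹ * (Y.toBlocks₂₁ᵀ * Y.toBlocks₂₁))
      + (1 / 2 : ℝ) • (Y.toBlocks₁₂ * Y.toBlocks₁₂ᵀ * diagonal s⁻¹) ∧
    (rotationRemainder s Y).toBlocks₂₂ = -(Y.toBlocks₂₁ * diagonal s⁻¹ * Y.toBlocks₁₂) := by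
  have hY : rotationRemainder s Y = leftRotation s Y * fromBlocks Y.toBlocks₁₁ Y.toBlocks₁₂
        Y.toBlocks₂₁ Y.toBlocks₂₂ + fromBlocks Y.toBlocks₁₁ Y.toBlocks₁₂
        Y.toBlocks₂₁ Y.toBlocks₂₂ * rightRotation s Y
    + leftRotation s Y * singularBlock μ ν s * rightRotation s Y
    + (1 / 2 : ℝ) • (leftRotation s Y * (leftRotation s Y * singularBlock μ ν s))
    + (1 / 2 : ℝ) • (singularBlock μ ν s * rightRotation s Y * rightRotation s Y) := by
    rw [fromBlocks_toBlocks]; rfl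
  rw [hY, leftRotation_mul hs, mul_rightRotation hs, leftRotation, rightRotation]
  simp only [fromBlocks_multiply, fromBlocks_add, fromBlocks_smul, toBlocks_fromBlocks₁₁,
    toBlocks_fromBlocks₂₂, Matrix.mul_zero, Matrix.zero_mul, Matrix.mul_neg, Matrix.neg_mul,
    add_zero, zero_add, Matrix.mul_assoc, neg_neg, smul_zero, neg_zero]
  constructor
  · module
  · module

lemma trace_rotationRemainder (hs : ∀ k, 0 < s k) (Y : Matrix (ρ ⊕ μ) (ρ ⊕ ν) ℝ) :
    trace (rotationRemainder s Y).toBlocks₁₁ =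
      ∑ j, ∑ k, (Y.toBlocks₁₁ j k - Y.toBlocks₁₁ k j) ^ 2 / (4 * (s j + s k))
      + (∑ j, ∑ k, (Y.toBlocks₁₂ k j) ^ 2 / (2 * s k)
        + ∑ j, ∑ k, (Y.toBlocks₂₁ j k) ^ 2 / (2 * s k)) := by
  rw [(rotationRemainder_eq hs Y).1]
  generalize Y.toBlocks₁₁ = A
  generalize Y.toBlocks₁₂ = B
  generalize Y.toBlocks₂₁ = C
  -- Averaging the double sum with its copy under `j ↔ k` produces the square; the same averaging in
  -- `h₂` turns the weight `s j` into `(s j + s k) / 2`.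
  have h₁ : trace (symmetrizer s A * A)
      = ∑ j, ∑ k, (A j k - A k j) ^ 2 / (2 * (s j + s k)) := by
    have e₁ : trace (symmetrizer s A * A) = ∑ j, ∑ k, (A k j - A j k) / (s j + s k) * A k j := by
      simp [trace, Matrix.mul_apply, symmetrizer_apply]
    have e₂ : trace (symmetrizer s A * A)
        = ∑ j, ∑ k, (A j k - A k j) / (s j + s k) * A j k := by
      rw [e₁, Finset.sum_comm]
      refine Finset.sum_congr rfl fun j _ => Finset.sum_congr rfl fun k _ => ?_
      rw [add_comm (s k)]
    have e₃ : trace (symmetrizer s A * A)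
        = (trace (symmetrizer s A * A) + trace (symmetrizer s A * A)) / 2 := by ring
    rw [e₃]
    nth_rewrite 1 [e₁]
    rw [e₂, ← Finset.sum_add_distrib, Finset.sum_div]
    refine Finset.sum_congr rfl fun j _ => ?_
    rw [← Finset.sum_add_distrib, Finset.sum_div]
    refine Finset.sum_congr rfl fun k _ => ?_
    have := (add_pos (hs j) (hs k)).ne'
    field_simp
    ring
  have h₂ : trace (symmetrizer s A * (symmetrizer s A * diagonal s))
      = -∑ j, ∑ k, (A j k - A k j) ^ 2 / (2 * (s j + s k)) := by
    have e₁ : trace (symmetrizer s A * (symmetrizer s A * diagonal s))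
        = -∑ j, ∑ k, (A j k - A k j) ^ 2 / (s j + s k) ^ 2 * s j := by
      simp only [trace, diag_apply, ← Matrix.mul_assoc, mul_diagonal]
      simp only [Matrix.mul_apply, symmetrizer_apply, Finset.sum_mul, ← Finset.sum_neg_distrib]
      refine Finset.sum_congr rfl fun j _ => Finset.sum_congr rfl fun k _ => ?_
      have := (add_pos (hs j) (hs k)).ne'
      rw [add_comm (s k)]
      field_simp
      ring
    have e₂ : ∑ j, ∑ k, (A j k - A k j) ^ 2 / (s j + s k) ^ 2 * s j
        = ∑ j, ∑ k, (A j k - A k j) ^ 2 / (s j + s k) ^ 2 * s k := by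
      rw [Finset.sum_comm]
      refine Finset.sum_congr rfl fun j _ => Finset.sum_congr rfl fun k _ => ?_
      rw [add_comm (s k), ← neg_sub (A j k), neg_sq]
    have e₃ : ∑ j, ∑ k, (A j k - A k j) ^ 2 / (s j + s k) ^ 2 * s j
        = (∑ j, ∑ k, (A j k - A k j) ^ 2 / (s j + s k) ^ 2 * s j
          + ∑ j, ∑ k, (A j k - A k j) ^ 2 / (s j + s k) ^ 2 * s j) / 2 := by ring
    rw [e₁, e₃]
    nth_rewrite 2 [e₂]
    rw [← Finset.sum_add_distrib, Finset.sum_div]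
    congr 1
    refine Finset.sum_congr rfl fun j _ => ?_
    rw [← Finset.sum_add_distrib, Finset.sum_div]
    refine Finset.sum_congr rfl fun k _ => ?_
    have := (add_pos (hs j) (hs k)).ne'
    field_simp
  have h₃ : trace (diagonal s⁻¹ * (Cᵀ * C)) = ∑ j, ∑ k, (C j k) ^ 2 / s k := by
    rw [Finset.sum_comm]
    simp only [trace, diag_apply, diagonal_mul]
    simp only [Matrix.mul_apply, transpose_apply, Finset.mul_sum, Pi.inv_apply]
    refine Finset.sum_congr rfl fun j _ => Finset.sum_congr rfl fun k _ => ?_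
    ring
  have h₄ : trace (B * Bᵀ * diagonal s⁻¹) = ∑ j, ∑ k, (B k j) ^ 2 / s k := by
    rw [Finset.sum_comm]
    simp only [trace, diag_apply, mul_diagonal]
    simp only [Matrix.mul_apply, transpose_apply, Finset.sum_mul, Pi.inv_apply]
    refine Finset.sum_congr rfl fun j _ => Finset.sum_congr rfl fun k _ => ?_
    ring
  have q : ∀ x y : ℝ, x / (4 * y) = x / (2 * y) * (1 / 2) := fun x y => by
    rw [show (4 : ℝ) * y = 2 * y * 2 by ring, ← div_div, mul_one_div]
  have q' : ∀ x y : ℝ, x / (2 * y) = x / y * (1 / 2) := fun x y => by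
    rw [mul_comm, ← div_div, mul_one_div]
  simp only [trace_add, trace_smul, h₁, h₂, h₃, h₄, q, smul_eq_mul]
  simp only [q' _ (s _), ← Finset.sum_mul]
  ring

end Rotation

/-! ### Expansion of the rotated matrix up to third order. -/

section Expansion

variable {α ι κ : Type*} [Fintype ι] [Fintype κ] [DecidableEq ι] [DecidableEq κ]
  {l : Filter α} {ε : α → ℝ}

/-- Every term on the right contains at least three factors among `K₁`, `K₂`, `Y`, hence is cubic
when these are small. -/
lemma expTwo_mul_mul_expTwo (K₁ : Matrix ι ι ℝ) (K₂ : Matrix κ κ ℝ) (S Y : Matrix ι κ ℝ) :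
    expTwo K₁ * (S + Y) * expTwo K₂ - (S + (K₁ * S + S * K₂ + Y)
      + (K₁ * Y + Y * K₂ + K₁ * S * K₂ + (1 / 2 : ℝ) • (K₁ * (K₁ * S))
        + (1 / 2 : ℝ) • (S * K₂ * K₂)))
      = K₁ * Y * K₂ + (1 / 2 : ℝ) • (K₁ * K₁ * Y * expTwo K₂)
        + (1 / 2 : ℝ) • (Y * K₂ * K₂) + (1 / 2 : ℝ) • (K₁ * Y * K₂ * K₂)
        + (1 / 2 : ℝ) • (K₁ * K₁ * S * K₂) + (1 / 2 : ℝ) • (K₁ * S * K₂ * K₂)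
        + (1 / 4 : ℝ) • (K₁ * K₁ * S * K₂ * K₂) := by
  simp only [expTwo, Matrix.mul_add, Matrix.add_mul, Matrix.smul_mul, Matrix.mul_smul,
    Matrix.one_mul, Matrix.mul_one, Matrix.mul_assoc]
  module

lemma isBigO_expTwo (hε : Tendsto ε l (𝓝 0)) {K : α → Matrix κ κ ℝ}
    (hK : K =O[l] fun t => ε t ^ 1) : (fun t => expTwo (K t)) =O[l] fun t => ε t ^ 0 :=
  ((isBigO_const_pow_zero 1).add (isBigO_pow_of_le hε (Nat.zero_le _) hK)).add
    (isBigO_smul _ (isBigO_mul_pow_le hε (Nat.zero_le _) hK hK))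

lemma isBigO_expTwo_conj (hε : Tendsto ε l (𝓝 0)) {K₁ : α → Matrix ι ι ℝ} {K₂ : α → Matrix κ κ ℝ}
    {Y : α → Matrix ι κ ℝ} (S : Matrix ι κ ℝ) (h₁ : K₁ =O[l] fun t => ε t ^ 1)
    (h₂ : K₂ =O[l] fun t => ε t ^ 1) (hY : Y =O[l] fun t => ε t ^ 1) :
    (fun t => expTwo (K₁ t) * (S + Y t) * expTwo (K₂ t)
      - (S + (K₁ t * S + S * K₂ t + Y t)
        + (K₁ t * Y t + Y t * K₂ t + K₁ t * S * K₂ t + (1 / 2 : ℝ) • (K₁ t * (K₁ t * S))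
          + (1 / 2 : ℝ) • (S * K₂ t * K₂ t)))) =O[l] fun t => ε t ^ 3 := by
  simp only [expTwo_mul_mul_expTwo]
  have hS : (fun _ : α => S) =O[l] fun t => ε t ^ 0 := isBigO_const_pow_zero S
  have h₁₁ : (fun t => K₁ t * K₁ t) =O[l] fun t => ε t ^ 2 := isBigO_mul_pow h₁ h₁
  have h₁Y : (fun t => K₁ t * Y t) =O[l] fun t => ε t ^ 2 := isBigO_mul_pow h₁ hY
  have h₁₁S : (fun t => K₁ t * K₁ t * S) =O[l] fun t => ε t ^ 2 := isBigO_mul_pow h₁₁ hS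
  have h₁S : (fun t => K₁ t * S) =O[l] fun t => ε t ^ 1 := isBigO_mul_pow h₁ hS
  have e₁ : (fun t => K₁ t * Y t * K₂ t) =O[l] fun t => ε t ^ 3 := isBigO_mul_pow h₁Y h₂
  have e₂ : (fun t => K₁ t * K₁ t * Y t * expTwo (K₂ t)) =O[l] fun t => ε t ^ 3 :=
    isBigO_mul_pow (isBigO_mul_pow h₁₁ hY) (isBigO_expTwo hε h₂)
  have e₃ : (fun t => Y t * K₂ t * K₂ t) =O[l] fun t => ε t ^ 3 :=
    isBigO_mul_pow (isBigO_mul_pow hY h₂) h₂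
  have e₄ : (fun t => K₁ t * Y t * K₂ t * K₂ t) =O[l] fun t => ε t ^ 3 :=
    isBigO_mul_pow_le hε (by norm_num) e₁ h₂
  have e₅ : (fun t => K₁ t * K₁ t * S * K₂ t) =O[l] fun t => ε t ^ 3 := isBigO_mul_pow h₁₁S h₂
  have e₆ : (fun t => K₁ t * S * K₂ t * K₂ t) =O[l] fun t => ε t ^ 3 :=
    isBigO_mul_pow (isBigO_mul_pow h₁S h₂) h₂
  have e₇ : (fun t => K₁ t * K₁ t * S * K₂ t * K₂ t) =O[l] fun t => ε t ^ 3 :=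
    isBigO_mul_pow_le hε (by norm_num) e₅ h₂
  exact (((((e₁.add (isBigO_smul _ e₂)).add (isBigO_smul _ e₃)).add (isBigO_smul _ e₄)).add
    (isBigO_smul _ e₅)).add (isBigO_smul _ e₆)).add (isBigO_smul _ e₇)

/-- The rotations `L₁`, `L₂` are already quadratic, so they act at second order only through `S`;
first-order rotations `1 + L` are enough here. -/
lemma isBigO_one_add_conj (hε : Tendsto ε l (𝓝 0)) {L₁ : α → Matrix ι ι ℝ} {L₂ : α → Matrix κ κ ℝ}
    {T N : α → Matrix ι κ ℝ} (S : Matrix ι κ ℝ) (h₁ : L₁ =O[l] fun t => ε t ^ 2)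
    (h₂ : L₂ =O[l] fun t => ε t ^ 2) (hT : T =O[l] fun t => ε t ^ 1)
    (hN : N =O[l] fun t => ε t ^ 2) :
    (fun t => (1 + L₁ t) * (S + T t + N t) * (1 + L₂ t)
      - (S + T t + (L₁ t * S + S * L₂ t + N t))) =O[l] fun t => ε t ^ 3 := by
  have hS : (fun _ : α => S) =O[l] fun t => ε t ^ 0 := isBigO_const_pow_zero S
  have e : ∀ t, (1 + L₁ t) * (S + T t + N t) * (1 + L₂ t)
      - (S + T t + (L₁ t * S + S * L₂ t + N t)) = L₁ t * T t + L₁ t * N t + T t * L₂ t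
        + N t * L₂ t + L₁ t * (S + T t + N t) * L₂ t := fun t => by
    simp only [Matrix.mul_add, Matrix.add_mul, Matrix.one_mul, Matrix.mul_one, Matrix.mul_assoc]
    abel
  simp only [e]
  have hX : (fun t => S + T t + N t) =O[l] fun t => ε t ^ 0 :=
    (hS.add (isBigO_pow_of_le hε (by norm_num) hT)).add (isBigO_pow_of_le hε (by norm_num) hN)
  have e₁ : (fun t => L₁ t * T t) =O[l] fun t => ε t ^ 3 := isBigO_mul_pow h₁ hT
  have e₂ : (fun t => L₁ t * N t) =O[l] fun t => ε t ^ 3 :=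
    isBigO_mul_pow_le hε (by norm_num) h₁ hN
  have e₃ : (fun t => T t * L₂ t) =O[l] fun t => ε t ^ 3 := isBigO_mul_pow hT h₂
  have e₄ : (fun t => N t * L₂ t) =O[l] fun t => ε t ^ 3 :=
    isBigO_mul_pow_le hε (by norm_num) hN h₂
  have e₅ : (fun t => L₁ t * (S + T t + N t) * L₂ t) =O[l] fun t => ε t ^ 3 :=
    isBigO_mul_pow_le hε (by norm_num) (isBigO_mul_pow h₁ hX) h₂
  exact (((e₁.add e₂).add e₃).add e₄).add e₅

end Expansion

/-! ### Third-order asymptotics of the trace norm. -/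

section Asymptotics

variable {α ρ μ ν : Type*} [Fintype ρ] [Fintype μ] [Fintype ν]
  [DecidableEq ρ] [DecidableEq μ] [DecidableEq ν] {s : ρ → ℝ} {l : Filter α} {ε : α → ℝ}

lemma isBigO_rotationRemainder {Y : α → Matrix (ρ ⊕ μ) (ρ ⊕ ν) ℝ}
    (hY : Y =O[l] fun t => ε t ^ 1) :
    (fun t => rotationRemainder s (Y t)) =O[l] fun t => ε t ^ 2 := by
  have h₁ := isBigO_linear (isLinearMap_leftRotation s) hY
  have h₂ := isBigO_linear (isLinearMap_rightRotation s) hY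
  have hS : (fun _ : α => singularBlock μ ν s) =O[l] fun t => ε t ^ 0 := isBigO_const_pow_zero _
  have h₁S := isBigO_mul_pow h₁ hS
  exact ((((isBigO_mul_pow h₁ hY).add (isBigO_mul_pow hY h₂)).add (isBigO_mul_pow h₁S h₂)).add
    (isBigO_smul _ (isBigO_mul_pow h₁ h₁S))).add
    (isBigO_smul _ (isBigO_mul_pow (isBigO_mul_pow hS h₂) h₂))

/-- Up to third order, the trace norm of a perturbation is that of its normal form. -/
lemma isBigO_traceNorm_normalForm (hs : ∀ k, 0 < s k) (hε : Tendsto ε l (𝓝 0))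
    {Y : α → Matrix (ρ ⊕ μ) (ρ ⊕ ν) ℝ} (hY : Y =O[l] fun t => ε t ^ 1) :
    (fun t => traceNorm (singularBlock μ ν s + Y t)
      - traceNorm (singularBlock μ ν s + normalForm s (Y t + rotationRemainder s (Y t))))
      =O[l] fun t => ε t ^ 3 := by
  set S := singularBlock μ ν s with hSdef
  set N := fun t => rotationRemainder s (Y t) with hNdef
  have hS : (fun _ : α => S) =O[l] fun t => ε t ^ 0 := isBigO_const_pow_zero _
  have hN : N =O[l] fun t => ε t ^ 2 := isBigO_rotationRemainder hY
  have hT := isBigO_linear (isLinearMap_normalForm s) hY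
  have hK₁ := isBigO_linear (isLinearMap_leftRotation s) hY
  have hK₂ := isBigO_linear (isLinearMap_rightRotation s) hY
  have hL₁ := isBigO_linear (isLinearMap_leftRotation s) hN
  have hL₂ := isBigO_linear (isLinearMap_rightRotation s) hN
  have e₁ := isBigO_expTwo_conj hε S hK₁ hK₂ hY
  have e₂ := isBigO_one_add_conj hε S hL₁ hL₂ hT hN
  -- This identifies the linear part for `Y` and the quadratic part for `N` as normal forms, which
  -- add up by linearity.
  simp only [hSdef, rotation_add hs] at e₁ e₂
  simp only [← hSdef] at e₁ e₂
  have hX : (fun t => S + Y t) =O[l] fun t => ε t ^ 0 :=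
    hS.add (isBigO_pow_of_le hε (by norm_num) hY)
  have hX' : (fun t => S + normalForm s (Y t) + N t) =O[l] fun t => ε t ^ 0 :=
    (hS.add (isBigO_pow_of_le hε (by norm_num) hT)).add (isBigO_pow_of_le hε (by norm_num) hN)
  have r₁ : (fun t => traceNorm (expTwo (leftRotation s (Y t)) * (S + Y t)
      * expTwo (rightRotation s (Y t))) - traceNorm (S + Y t)) =O[l] fun t => ε t ^ (3 + 0) := by
    refine isBigO_traceNorm_conj_sub hε ?_ ?_ (isBigO_expTwo hε hK₁) hX
    · simp only [expTwo_transpose_mul_self_of_skew (leftRotation_transpose s _)]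
      exact isBigO_smul _ (isBigO_mul_pow_le hε (by norm_num) (isBigO_mul_pow hK₁ hK₁)
        (isBigO_mul_pow hK₁ hK₁))
    · simp only [expTwo_mul_transpose_of_skew (rightRotation_transpose s _)]
      exact isBigO_smul _ (isBigO_mul_pow_le hε (by norm_num) (isBigO_mul_pow hK₂ hK₂)
        (isBigO_mul_pow hK₂ hK₂))
  have r₂ : (fun t => traceNorm ((1 + leftRotation s (N t)) * (S + normalForm s (Y t) + N t)
      * (1 + rightRotation s (N t))) - traceNorm (S + normalForm s (Y t) + N t))
      =O[l] fun t => ε t ^ (3 + 0) := by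
    refine isBigO_traceNorm_conj_sub hε ?_ ?_ ?_ hX'
    · simp only [one_add_transpose_mul_self_of_skew (leftRotation_transpose s _)]
      exact isBigO_pow_of_le hε (by norm_num) (isBigO_mul_pow hL₁ hL₁).neg_left
    · simp only [one_add_mul_transpose_of_skew (rightRotation_transpose s _)]
      exact isBigO_pow_of_le hε (by norm_num) (isBigO_mul_pow hL₂ hL₂).neg_left
    · exact (isBigO_const_pow_zero 1).add (isBigO_pow_of_le hε (by norm_num) hL₁)
  have t₁ := isBigO_traceNorm_sub e₁
  have t₂ := isBigO_traceNorm_sub e₂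
  refine (((t₁.sub r₁).add t₂).sub r₂).congr_left fun t => ?_
  simp only [(isLinearMap_normalForm s).map_add, hNdef, rotationRemainder, hSdef, add_assoc]
  ring

/-- A small symmetric perturbation of a positive diagonal matrix is positive semidefinite. -/
lemma eventually_posSemidef_diagonal_add (hs : ∀ k, 0 < s k) {H : α → Matrix ρ ρ ℝ}
    (hH : Tendsto H l (𝓝 0)) (hsymm : ∀ t, (H t).IsSymm) :
    ∀ᶠ t in l, (diagonal s + H t).PosSemidef := by
  obtain ⟨c, hc, hcs⟩ : ∃ c > 0, ∀ k, c ≤ s k := by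
    rcases isEmpty_or_nonempty ρ with h | h
    · exact ⟨1, one_pos, fun k => (IsEmpty.false k).elim⟩
    · obtain ⟨k, hk⟩ := Finite.exists_min s
      exact ⟨s k, hs k, hk⟩
  have hn : Tendsto (fun t => ‖H t‖) l (𝓝 0) := by simpa using hH.norm
  filter_upwards [hn.eventually (gt_mem_nhds hc)] with t ht
  refine Matrix.PosSemidef.of_dotProduct_mulVec_nonneg ?_ fun x => ?_
  · rw [Matrix.IsHermitian, Matrix.conjTranspose_eq_transpose_of_trivial, transpose_add,
      diagonal_transpose, (hsymm t).eq]
  · rw [add_mulVec, dotProduct_add, star_trivial]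
    have h₁ : c * ‖WithLp.toLp 2 x‖ ^ 2 ≤ x ⬝ᵥ diagonal s *ᵥ x := by
      rw [EuclideanSpace.norm_sq_eq, Finset.mul_sum]
      refine Finset.sum_le_sum fun k _ => ?_
      rw [mulVec_diagonal, Real.norm_eq_abs, sq_abs]
      nlinarith [mul_le_mul_of_nonneg_right (hcs k) (sq_nonneg (x k))]
    have h₂ : |x ⬝ᵥ H t *ᵥ x| ≤ ‖H t‖ * ‖WithLp.toLp 2 x‖ ^ 2 := by
      have h₃ := abs_real_inner_le_norm (WithLp.toLp 2 (H t *ᵥ x)) (WithLp.toLp 2 x)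
      have h₄ := (norm_mulVec_le (H t) x).trans
        (mul_le_mul_of_nonneg_right (opNorm_le_norm (H t)) (norm_nonneg _))
      rw [EuclideanSpace.inner_toLp_toLp, star_trivial] at h₃
      refine h₃.trans ?_
      rw [sq, ← mul_assoc]
      exact mul_le_mul_of_nonneg_right h₄ (norm_nonneg _)
    have h₅ := (abs_le.1 h₂).1
    nlinarith [sq_nonneg ‖WithLp.toLp 2 x‖]

lemma isBigO_traceNorm_expansion (hs : ∀ k, 0 < s k) (hε : Tendsto ε l (𝓝 0))
    {Y : α → Matrix (ρ ⊕ μ) (ρ ⊕ ν) ℝ} (hY : Y =O[l] fun t => ε t ^ 1) :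
    (fun t => traceNorm (singularBlock μ ν s + Y t)
      - (∑ k, s k + trace (Y t).toBlocks₁₁ + trace (rotationRemainder s (Y t)).toBlocks₁₁
        + traceNorm ((Y t).toBlocks₂₂ - (Y t).toBlocks₂₁ * diagonal s⁻¹ * (Y t).toBlocks₁₂)))
      =O[l] fun t => ε t ^ 3 := by
  have hZ : (fun t => Y t + rotationRemainder s (Y t)) =O[l] fun t => ε t ^ 1 :=
    hY.add (isBigO_pow_of_le hε (by norm_num) (isBigO_rotationRemainder hY))
  -- The equality holds only eventually: the upper block must be close enough to `diagonal s` to be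
  -- positive semidefinite.
  refine (isBigO_traceNorm_normalForm hs hε hY).congr' ?_ (EventuallyEq.refl _ _)
  set H : α → Matrix ρ ρ ℝ := fun t => (Y t + rotationRemainder s (Y t)).toBlocks₁₁
    + symmetrizer s (Y t + rotationRemainder s (Y t)).toBlocks₁₁ * diagonal s with hHdef
  have hH : Tendsto H l (𝓝 0) := by
    have h₁ : (fun t => (Y t + rotationRemainder s (Y t)).toBlocks₁₁) =O[l] fun t => ε t ^ 1 :=
      isBigO_linear (f := toBlocks₁₁) ⟨fun _ _ => rfl, fun _ _ => rfl⟩ hZ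
    have h₂ : H =O[l] fun t => ε t ^ 1 :=
      h₁.add (isBigO_mul_pow (isBigO_linear (isLinearMap_symmetrizer s) h₁)
        (isBigO_const_pow_zero (diagonal s)))
    simp only [pow_one] at h₂
    exact h₂.trans_tendsto hε
  filter_upwards [eventually_posSemidef_diagonal_add hs hH
    fun t => add_symmetrizer_isSymm hs _] with t ht
  have h₁ : singularBlock μ ν s + normalForm s (Y t + rotationRemainder s (Y t))
      = fromBlocks (diagonal s + H t) 0 0 (Y t + rotationRemainder s (Y t)).toBlocks₂₂ := by
    simp [singularBlock, normalForm, fromBlocks_add, hHdef]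
  have h₂ : (Y t + rotationRemainder s (Y t)).toBlocks₂₂
      = (Y t).toBlocks₂₂ - (Y t).toBlocks₂₁ * diagonal s⁻¹ * (Y t).toBlocks₁₂ := by
    rw [sub_eq_add_neg, ← (rotationRemainder_eq hs (Y t)).2]
    rfl
  have h₃ : trace (H t) = trace (Y t).toBlocks₁₁
      + trace (rotationRemainder s (Y t)).toBlocks₁₁ := by
    -- A skew matrix times a symmetric one has trace zero, so symmetrizing does not affect the
    -- trace.
    have e : ∀ A : Matrix ρ ρ ℝ, trace (symmetrizer s A * diagonal s) = 0 := fun A => by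
      have h := Matrix.trace_transpose (symmetrizer s A * diagonal s)
      rw [transpose_mul, diagonal_transpose, symmetrizer_transpose, Matrix.mul_neg, trace_neg,
        Matrix.trace_mul_comm] at h
      linarith
    rw [hHdef, trace_add, e, add_zero, ← trace_add]
    rfl
  rw [h₁, traceNorm_fromBlocks_diag, traceNorm_of_posSemidef ht, trace_add, trace_diagonal, h₃, h₂,
    ← add_assoc (∑ k, s k)]

/-- The correction blocks of `Q` only change its trace norm to third order. -/
lemma isBigO_traceNorm_corrected (hε : Tendsto ε l (𝓝 0))
    {B : α → Matrix ρ ν ℝ} {C : α → Matrix μ ρ ℝ} {D : α → Matrix μ ν ℝ}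
    (hB : B =O[l] fun t => ε t ^ 1) (hC : C =O[l] fun t => ε t ^ 1)
    (hD : D =O[l] fun t => ε t ^ 1) :
    (fun t => traceNorm (fromBlocks (0 : Matrix ρ ρ ℝ) (-(diagonal s⁻¹ * (C t)ᵀ * D t))
        (-(D t * (B t)ᵀ * diagonal s⁻¹)) (D t - C t * diagonal s⁻¹ * B t))
      - traceNorm (D t - C t * diagonal s⁻¹ * B t)) =O[l] fun t => ε t ^ 3 := by
  set K₁ : α → Matrix (ρ ⊕ μ) (ρ ⊕ μ) ℝ := fun t =>
    leftRotation s (fromBlocks 0 (B t) (C t) 0) with hK₁def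
  set K₂ : α → Matrix (ρ ⊕ ν) (ρ ⊕ ν) ℝ := fun t =>
    rightRotation s (fromBlocks 0 (B t) (C t) (0 : Matrix μ ν ℝ)) with hK₂def
  set G : α → Matrix μ ν ℝ := fun t => C t * diagonal s⁻¹ * B t with hGdef
  set F : α → Matrix (ρ ⊕ μ) (ρ ⊕ ν) ℝ := fun t => fromBlocks 0 (-(diagonal s⁻¹ * (C t)ᵀ * D t))
    (-(D t * (B t)ᵀ * diagonal s⁻¹)) 0 with hFdef
  set P : α → Matrix (ρ ⊕ μ) (ρ ⊕ ν) ℝ := fun t => fromBlocks 0 0 0 (D t - G t) with hPdef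
  set R : α → Matrix (ρ ⊕ μ) (ρ ⊕ ν) ℝ := fun t => fromBlocks 0 0 0 (G t) with hRdef
  have hs' : (fun _ : α => diagonal s⁻¹) =O[l] fun t => ε t ^ 0 := isBigO_const_pow_zero _
  have hG : G =O[l] fun t => ε t ^ 2 := isBigO_mul_pow (isBigO_mul_pow hC hs') hB
  have hE : (fun t => fromBlocks (0 : Matrix ρ ρ ℝ) (B t) (C t) (0 : Matrix μ ν ℝ))
      =O[l] fun t => ε t ^ 1 :=
    isBigO_fromBlocks (isBigO_zero _ _) hB hC (isBigO_zero _ _)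
  have hK₁ : K₁ =O[l] fun t => ε t ^ 1 := isBigO_linear (isLinearMap_leftRotation s) hE
  have hK₂ : K₂ =O[l] fun t => ε t ^ 1 := isBigO_linear (isLinearMap_rightRotation s) hE
  have hF : F =O[l] fun t => ε t ^ 2 :=
    isBigO_fromBlocks (isBigO_zero _ _)
      (isBigO_mul_pow (isBigO_mul_pow hs' (isBigO_transpose hC)) hD).neg_left
      (isBigO_mul_pow (isBigO_mul_pow hD (isBigO_transpose hB)) hs').neg_left (isBigO_zero _ _)
  have hP : P =O[l] fun t => ε t ^ 1 :=
    isBigO_fromBlocks (isBigO_zero _ _) (isBigO_zero _ _) (isBigO_zero _ _)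
      (hD.sub (isBigO_pow_of_le hε (by norm_num) hG))
  have hR : R =O[l] fun t => ε t ^ 2 :=
    isBigO_fromBlocks (isBigO_zero _ _) (isBigO_zero _ _) (isBigO_zero _ _) hG
  have hX : (fun t => F t + P t) =O[l] fun t => ε t ^ 1 :=
    (isBigO_pow_of_le hε (by norm_num) hF).add hP
  have hPR : ∀ t, P t + R t = fromBlocks 0 0 0 (D t) := fun t => by
    simp [hPdef, hRdef, fromBlocks_add]
  -- The rotations are those of the perturbation with `A = D = 0`. Applied to `0 ⊕ D` they produce
  -- exactly the negatives of the off-diagonal blocks of `Q`. Using `D` instead of `D - G` costs `K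
  -- * R`, which is cubic.
  have hcancel : ∀ t, F t + K₁ t * (P t + R t) + (P t + R t) * K₂ t = 0 := fun t => by
    rw [hPR]
    simp [hFdef, hK₁def, hK₂def, leftRotation, rightRotation, fromBlocks_multiply,
      fromBlocks_add, Matrix.mul_assoc]
  have hconj : ∀ t, (1 + K₁ t) * (F t + P t) * (1 + K₂ t) - P t
      = K₁ t * F t + F t * K₂ t + K₁ t * (F t + P t) * K₂ t - K₁ t * R t - R t * K₂ t := fun t => by
    have h := hcancel t
    rw [← sub_eq_zero]
    rw [← h]
    simp only [Matrix.mul_add, Matrix.add_mul, Matrix.one_mul, Matrix.mul_one, Matrix.mul_assoc]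
    abel
  have t₁ : (fun t => (1 + K₁ t) * (F t + P t) * (1 + K₂ t) - P t) =O[l] fun t => ε t ^ 3 := by
    simp only [hconj]
    have e₁ : (fun t => K₁ t * F t) =O[l] fun t => ε t ^ 3 := isBigO_mul_pow hK₁ hF
    have e₂ : (fun t => F t * K₂ t) =O[l] fun t => ε t ^ 3 := isBigO_mul_pow hF hK₂
    have e₃ : (fun t => K₁ t * (F t + P t) * K₂ t) =O[l] fun t => ε t ^ 3 :=
      isBigO_mul_pow (isBigO_mul_pow hK₁ hX) hK₂
    have e₄ : (fun t => K₁ t * R t) =O[l] fun t => ε t ^ 3 := isBigO_mul_pow hK₁ hR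
    have e₅ : (fun t => R t * K₂ t) =O[l] fun t => ε t ^ 3 := isBigO_mul_pow hR hK₂
    exact (((e₁.add e₂).add e₃).sub e₄).sub e₅
  have r₁ : (fun t => traceNorm ((1 + K₁ t) * (F t + P t) * (1 + K₂ t)) - traceNorm (F t + P t))
      =O[l] fun t => ε t ^ (2 + 1) := by
    refine isBigO_traceNorm_conj_sub hε ?_ ?_ ?_ hX
    · simp only [hK₁def, one_add_transpose_mul_self_of_skew (leftRotation_transpose s _)]
      exact (isBigO_mul_pow hK₁ hK₁).neg_left
    · simp only [hK₂def, one_add_mul_transpose_of_skew (rightRotation_transpose s _)]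
      exact (isBigO_mul_pow hK₂ hK₂).neg_left
    · exact (isBigO_const_pow_zero 1).add (isBigO_pow_of_le hε (by norm_num) hK₁)
  refine ((isBigO_traceNorm_sub t₁).sub r₁).congr_left fun t => ?_
  have h₁ : traceNorm (P t) = traceNorm (D t - G t) := by
    simp only [hPdef]
    rw [traceNorm_fromBlocks_diag, traceNorm_zero, zero_add]
  have h₂ : F t + P t = fromBlocks (0 : Matrix ρ ρ ℝ) (-(diagonal s⁻¹ * (C t)ᵀ * D t))
      (-(D t * (B t)ᵀ * diagonal s⁻¹)) (D t - G t) := by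
    simp [hFdef, hPdef, fromBlocks_add]
  rw [h₁, ← h₂]
  ring

end Asymptotics

/-! ### Passage to the bases adapted to the decomposition. -/

section Coordinates

variable {n p r : ℕ}

lemma le_of_transpose_mul_self_eq_one {U : Matrix (Fin n) (Fin r) ℝ} (hU : Uᵀ * U = 1) : r ≤ n := by
  have h₁ := Matrix.rank_mul_le_right Uᵀ U
  have h₂ := U.rank_le_height
  rw [hU, Matrix.rank_one, Fintype.card_fin] at h₁
  exact h₁.trans h₂

lemma transpose_fromCols_mul {m : ℕ} (U : Matrix (Fin n) (Fin r) ℝ)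
    (U₀ : Matrix (Fin n) (Fin (n - r)) ℝ) (V : Matrix (Fin p) (Fin r) ℝ)
    (V₀ : Matrix (Fin p) (Fin m) ℝ) (X : Matrix (Fin n) (Fin p) ℝ) :
    (fromCols U U₀)ᵀ * X * fromCols V V₀
      = fromBlocks (Uᵀ * X * V) (Uᵀ * X * V₀) (U₀ᵀ * X * V) (U₀ᵀ * X * V₀) := by
  rw [transpose_fromCols, fromRows_mul, fromRows_mul_fromCols]

lemma IsOrthonormalCompletion.transpose_mul_self {U : Matrix (Fin n) (Fin r) ℝ}
    {U₀ : Matrix (Fin n) (Fin (n - r)) ℝ} (hU : Uᵀ * U = 1) (h : IsOrthonormalCompletion U U₀) :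
    (fromCols U U₀)ᵀ * fromCols U U₀ = 1 := by
  have h' : U₀ᵀ * U = 0 := by
    rw [← transpose_inj, transpose_mul, transpose_transpose, h.orthogonal, transpose_zero]
  rw [transpose_fromCols, fromRows_mul_fromCols, hU, h.orthonormal, h.orthogonal, h',
    fromBlocks_one]

lemma IsOrthonormalCompletion.mul_transpose_self {U : Matrix (Fin n) (Fin r) ℝ}
    {U₀ : Matrix (Fin n) (Fin (n - r)) ℝ} (hU : Uᵀ * U = 1) (h : IsOrthonormalCompletion U U₀) :
    fromCols U U₀ * (fromCols U U₀)ᵀ = 1 := by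
  refine (Matrix.mul_eq_one_comm_of_card_eq _ _ _ ?_).1 (h.transpose_mul_self hU)
  -- The subtraction `n - r` is truncated; `r ≤ n` gives `r + (n - r) = n`, so a one-sided inverse
  -- is two-sided.
  have := le_of_transpose_mul_self_eq_one hU
  simp only [Fintype.card_sum, Fintype.card_fin]
  omega

lemma col_dotProduct_mulVec_col {m k : ℕ} (U : Matrix (Fin n) (Fin m) ℝ)
    (Δ : Matrix (Fin n) (Fin p) ℝ) (V : Matrix (Fin p) (Fin k) ℝ) (i : Fin m) (j : Fin k) :
    U.col i ⬝ᵥ Δ *ᵥ V.col j = (Uᵀ * Δ * V) i j := by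
  rw [← col_mul_eq_mulVec, Matrix.mul_assoc]
  simp [Matrix.mul_apply, dotProduct]

lemma IsSVD.transpose_mul_mul {M : Matrix (Fin n) (Fin p) ℝ} {U : Matrix (Fin n) (Fin r) ℝ}
    {s : Fin r → ℝ} {V : Matrix (Fin p) (Fin r) ℝ} (hM : IsSVD M U s V)
    {U₀ : Matrix (Fin n) (Fin (n - r)) ℝ} (hU₀ : IsOrthonormalCompletion U U₀)
    {V₀ : Matrix (Fin p) (Fin (p - r)) ℝ} (hV₀ : IsOrthonormalCompletion V V₀) :
    (fromCols U U₀)ᵀ * M * fromCols V V₀ = singularBlock (Fin (n - r)) (Fin (p - r)) s := by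
  have h : U₀ᵀ * U = 0 := by
    rw [← transpose_inj, transpose_mul, transpose_transpose, hU₀.orthogonal, transpose_zero]
  rw [transpose_fromCols_mul, hM.eq_mul, singularBlock]
  simp only [Matrix.mul_assoc, hM.orthonormal_right, hV₀.orthogonal, Matrix.mul_zero,
    Matrix.mul_one]
  simp only [← Matrix.mul_assoc, hM.orthonormal_left, h, Matrix.zero_mul, Matrix.one_mul]

end Coordinates

end TraceNorm

/-! ### The second-order expansion. -/

theorem proposition6 {n p r : ℕ} (M : Matrix (Fin n) (Fin p) ℝ)
    (U : Matrix (Fin n) (Fin r) ℝ) (s : Fin r → ℝ) (V : Matrix (Fin p) (Fin r) ℝ)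
    (hM : TraceNorm.IsSVD M U s V)
    (U₀ : Matrix (Fin n) (Fin (n - r)) ℝ) (hU₀ : TraceNorm.IsOrthonormalCompletion U U₀)
    (V₀ : Matrix (Fin p) (Fin (p - r)) ℝ) (hV₀ : TraceNorm.IsOrthonormalCompletion V V₀) :
    (fun Δ : Matrix (Fin n) (Fin p) ℝ =>
      TraceNorm.traceNorm (M + Δ) -
        (TraceNorm.traceNorm M + TraceNorm.traceNorm (TraceNorm.Q U s V U₀ V₀ Δ)
          + Matrix.trace (V * Uᵀ * Δ)
          + ∑ j, ∑ k, (U.col j ⬝ᵥ Δ *ᵥ V.col k - U.col k ⬝ᵥ Δ *ᵥ V.col j) ^ 2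
              / (4 * (s j + s k))
          + (∑ j, ∑ k, (U.col k ⬝ᵥ Δ *ᵥ V₀.col j) ^ 2 / (2 * s k)
            + ∑ j, ∑ k, (U₀.col j ⬝ᵥ Δ *ᵥ V.col k) ^ 2 / (2 * s k))))
      =o[𝓝 0] fun Δ : Matrix (Fin n) (Fin p) ℝ => ‖Δ‖ ^ 2 := by
  open TraceNorm in
  have hs := hM.pos
  have hε : Tendsto (fun Δ : Matrix (Fin n) (Fin p) ℝ => ‖Δ‖) (𝓝 0) (𝓝 0) := tendsto_norm_zero
  have hinv : ∀ X : Matrix (Fin n) (Fin p) ℝ,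
      traceNorm ((fromCols U U₀)ᵀ * X * fromCols V V₀) = traceNorm X := fun X => by
    rw [traceNorm_mul_right_of_orthogonal (hV₀.mul_transpose_self hM.orthonormal_right),
      traceNorm_mul_left_of_orthogonal (by
        rw [transpose_transpose, hU₀.mul_transpose_self hM.orthonormal_left])]
  have hΔ : (fun Δ : Matrix (Fin n) (Fin p) ℝ => Δ) =O[𝓝 0] fun Δ => ‖Δ‖ ^ 1 := by
    simpa using (isBigO_refl (fun Δ : Matrix (Fin n) (Fin p) ℝ => Δ) (𝓝 0)).norm_right
  have hsand : ∀ {a b : ℕ} (X : Matrix (Fin n) (Fin a) ℝ) (Z : Matrix (Fin p) (Fin b) ℝ),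
      (fun Δ : Matrix (Fin n) (Fin p) ℝ => Xᵀ * Δ * Z) =O[𝓝 0] fun Δ => ‖Δ‖ ^ 1 := fun X Z =>
    isBigO_linear (f := fun Δ => Xᵀ * Δ * Z)
      ⟨fun _ _ => by rw [Matrix.mul_add, Matrix.add_mul],
        fun _ _ => by rw [Matrix.mul_smul, Matrix.smul_mul]⟩ hΔ
  have hY := isBigO_fromBlocks (hsand U V) (hsand U V₀) (hsand U₀ V) (hsand U₀ V₀)
  have e₁ := isBigO_traceNorm_expansion hs hε hY
  have e₂ := isBigO_traceNorm_corrected (s := s) hε (hsand U V₀) (hsand U₀ V) (hsand U₀ V₀)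
  have hlittle : (fun Δ : Matrix (Fin n) (Fin p) ℝ => ‖Δ‖ ^ 3) =o[𝓝 0] fun Δ => ‖Δ‖ ^ 2 :=
    (isLittleO_pow_pow (𝕜 := ℝ) (by norm_num : 2 < 3)).comp_tendsto hε
  have hMnorm : traceNorm M = ∑ k, s k := by
    rw [← hinv, hM.transpose_mul_mul hU₀ hV₀, singularBlock, traceNorm_fromBlocks_diag,
      traceNorm_zero, add_zero, traceNorm_of_posSemidef, trace_diagonal]
    exact Matrix.PosSemidef.diagonal fun k => (hs k).le
  -- Subtracting `e₂` replaces the trace norm of the lower block by that of `Q`; what remains is an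
  -- exact identity.
  refine ((e₁.sub e₂).congr_left fun Δ => ?_).trans_isLittleO hlittle
  have hadd : traceNorm (M + Δ) = traceNorm (singularBlock (Fin (n - r)) (Fin (p - r)) s
      + fromBlocks (Uᵀ * Δ * V) (Uᵀ * Δ * V₀) (U₀ᵀ * Δ * V) (U₀ᵀ * Δ * V₀)) := by
    rw [← hinv, Matrix.mul_add, Matrix.add_mul, hM.transpose_mul_mul hU₀ hV₀,
      transpose_fromCols_mul]
  have hQ : Q U s V U₀ V₀ Δ = fromBlocks (0 : Matrix (Fin r) (Fin r) ℝ)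
      (-(diagonal s⁻¹ * (U₀ᵀ * Δ * V)ᵀ * (U₀ᵀ * Δ * V₀)))
      (-(U₀ᵀ * Δ * V₀ * (Uᵀ * Δ * V₀)ᵀ * diagonal s⁻¹))
      (U₀ᵀ * Δ * V₀ - U₀ᵀ * Δ * V * diagonal s⁻¹ * (Uᵀ * Δ * V₀)) := by
    simp only [Q, transpose_mul, transpose_transpose, Matrix.mul_assoc]
  have htr : trace (V * Uᵀ * Δ) = trace (Uᵀ * Δ * V) := by
    rw [Matrix.mul_assoc, Matrix.trace_mul_comm]
  rw [hadd, hMnorm, hQ, htr, trace_rotationRemainder hs]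
  simp only [toBlocks_fromBlocks₁₁, toBlocks_fromBlocks₁₂, toBlocks_fromBlocks₂₁,
    toBlocks_fromBlocks₂₂, col_dotProduct_mulVec_col]
  ring
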